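/- Let $n\ge 2$, $1\le\beta<\frac{n+1}{2}$ and $\beta+\frac{n-1}{2}<\alpha<n$. Let $\sigma$ be the surface measure on the unit sphere $\mathbb S^{n-1}\subset\mathbb R^n$ and, for $f\in L^2(\mathbb S^{n-1},\sigma)$ (complex valued), put $$\widehat{f\,d\sigma}(x)=\int_{\mathbb S^{n-1}}e^{-ix\cdot\omega}f(\omega)\,d\sigma(\omega),\qquad x\in\mathbb R^n.$$ For a nonnegative locally integrable function $v$ on $\mathbb R^n$ put $$\|v\|_{\mathcal{KS}_\alpha}=\sup_Q\Big(\int_Q v(x)\,dx\Big)^{-1}\int_Q\int_Q\frac{v(x)v(y)}{|x-y|^{n-\alpha}}\,dx\,dy\in[0,\infty],$$ where the supremum is over all dyadic cubes $Q$ in $\mathbb R^n$ (cubes with $\int_Q v=0$ contribute $0$). Then there is a constant $C>0$, depending only on $n,\alpha,\beta$, such that for every $w:\mathbb R^n\to[0,\infty)$ with $w^\beta$ locally integrable and every $f\in L^2(\mathbb S^{n-1})$, $$\Big(\int_{\mathbb R^n}\big|\widehat{f\,d\sigma}(x)\big|^2\,w(x)\,dx\Big)^{1/2}\le C\,\|w^\beta\|_{\mathcal{KS}_\alpha}^{\frac1{2\beta}}\,\|f\|_{L^2(\mathbb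 S^{n-1})},$$ with the convention $\infty\cdot 0=0$ on the right-hand side. -/

import Mathlib

open MeasureTheory
open scoped ENNReal NNReal

noncomputable section

/-- The dyadic cube `∏ᵢ [mᵢ 2ᵏ, (mᵢ + 1) 2ᵏ)` in `ℝⁿ`, of side length `2ᵏ`, for `k ∈ ℤ` and
`m ∈ ℤⁿ`. -/
def dyadicCube {n : ℕ} (k : ℤ) (m : Fin n → ℤ) : Set (EuclideanSpace ℝ (Fin n)) :=
  {x | ∀ i, (m i : ℝ) * (2 : ℝ) ^ k ≤ x i ∧ x i < ((m i : ℝ) + 1) * (2 : ℝ) ^ k}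

/-- The Kerman–Sawyer quantity `‖w‖_{KS_α} ∈ [0, ∞]` of a nonnegative locally integrable function
`w` on `ℝⁿ`: the supremum over all dyadic cubes `Q` of
`(∫_Q w)⁻¹ ∫_Q ∫_Q w(x) w(y) / |x - y|^(n - α) dx dy`.
A cube with `∫_Q w = 0` contributes `∞ * 0 = 0`; `∫_Q w = ∞` does not occur for such `w`, and the
diagonal `x = y` is a null set. -/
def kermanSawyerNorm {n : ℕ} (α : ℝ) (w : EuclideanSpace ℝ (Fin n) → ℝ) : ℝ≥0∞ :=
  ⨆ (k : ℤ) (m : Fin n → ℤ),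
    (∫⁻ x in dyadicCube k m, ENNReal.ofReal (w x))⁻¹ *
      ∫⁻ x in dyadicCube k m, ∫⁻ y in dyadicCube k m,
        ENNReal.ofReal (w x * w y / ‖x - y‖ ^ ((n : ℝ) - α))

/-- The surface measure `σ` on the unit sphere of `ℝⁿ`, normalised by polar coordinates
`dx = r^(n-1) dr dσ`. -/
def surfaceMeasure (n : ℕ) : Measure (Metric.sphere (0 : EuclideanSpace ℝ (Fin n)) 1) :=
  (volume : Measure (EuclideanSpace ℝ (Fin n))).toSphere

/-- The Fourier transform of the measure `f dσ` on the unit sphere,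
`x ↦ ∫ e^{-i x·ω} f(ω) dσ(ω)`. -/
def fourierSphere {n : ℕ} (f : Metric.sphere (0 : EuclideanSpace ℝ (Fin n)) 1 → ℂ)
    (x : EuclideanSpace ℝ (Fin n)) : ℂ :=
  ∫ ω, Complex.exp (-(Complex.I * ((inner ℝ x (ω : EuclideanSpace ℝ (Fin n)) : ℝ) : ℂ))) * f ω
    ∂(surfaceMeasure n)

/-- The measure `w(x) dx` on `ℝⁿ`, so that `L²(w)` is `L²` of this measure. -/
def weightMeasure {n : ℕ} (w : EuclideanSpace ℝ (Fin n) → ℝ) :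
    Measure (EuclideanSpace ℝ (Fin n)) :=
  volume.withDensity (fun x => ENNReal.ofReal (w x))

end

/-!
The operator `f ↦ (f dσ)^` is bounded from `L²(σ)` to `L²(w)` as soon as the form
`∫∫ σ̂(x - y) u(x) conj (u(y)) dx dy` is bounded by a multiple of `∫ |u|² / w`
(`exists_lintegral_fourierSphere_sq_le` deduces the former from the latter). Two bounds for
convolution kernels are played against each other.

* A Gaussian truncation `σ̂(x) e^{-|x|²/R²}` acts on `L²` with norm `O(R)`, because its Fourier
  transform is a smoothing of `σ` at scale `1 / R` (`exists_enorm_convForm_gaussian_le`).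
* A kernel of size `max(R, |x|)^{-(n-1)/2}` acts between weighted spaces for the weight `v = w^β`
  with norm `O(R^{(n+1)/2 - α})` by Schur's test. All that is needed of the Kerman–Sawyer norm is
  that it bounds the mass of a ball of radius `r` by a multiple of `r^{n-α}`
  (`exists_setLIntegral_ball_le`).

By the stationary phase estimate `|σ̂(x)| ≲ |x|^{-(n-1)/2}` (`exists_norm_fourierSphere_one_le`) the
kernel `σ̂` is a sum of Gaussian truncations at scale `R` and a remainder of the second kind, for
each `R ≥ 1` (`exists_enorm_convForm_fourierSphere_le`). No complex interpolation is used to pass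
from the weights `1` and `w^β` to `w`: the function `u` is cut along the level sets `w ≈ 2ᵏ`, and
for each pair of levels `k`, `l` the scale `R` is chosen as a power of `2^{-(k+l)}`, or `R = 1`
without Gaussian part if `k + l ≥ 0`. If `β > 1`, the strict inequality `α > β + (n-1)/2` makes all
contributions decay geometrically in `|k + l|` (`exists_enorm_convForm_levels_le`), and such a
matrix is bounded on `ℓ²`. For `β = 1` Schur's test alone suffices.

The stationary phase estimate itself is obtained by slicing the ball along the direction of `x`,
which leads to integrals of `e^{iλt} (1 - t²)^{(n-1)/2}` over `[-1, 1]`; these are estimated by moving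
the path of integration to the half lines `±1 + i [0, ∞)`. The sphere is recovered from the ball by
differentiating in the radius.
-/

/-! ### Plane waves, the Fourier transform and bilinear forms with a convolution kernel -/

/-- The plane wave `e^{-i x·ξ}`. -/
noncomputable def planeWave {n : ℕ} (x ξ : EuclideanSpace ℝ (Fin n)) : ℂ :=
  Complex.exp (-(Complex.I * ((inner ℝ x ξ : ℝ) : ℂ)))

/-- The Fourier transform `ξ ↦ ∫ e^{-i x·ξ} h(x) dx`, without a factor `2π` in the exponent so that
it matches `fourierSphere`. -/
noncomputable def waveTransform {n : ℕ} (h : EuclideanSpace ℝ (Fin n) → ℂ)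
    (ξ : EuclideanSpace ℝ (Fin n)) : ℂ :=
  ∫ x, planeWave x ξ * h x

/-- The sesquilinear form `∫∫ K(x - y) h(x) conj (g(y)) dx dy`. -/
noncomputable def convForm {n : ℕ} (K h g : EuclideanSpace ℝ (Fin n) → ℂ) : ℂ :=
  ∫ p : EuclideanSpace ℝ (Fin n) × EuclideanSpace ℝ (Fin n),
    K (p.1 - p.2) * (h p.1 * (starRingEnd ℂ) (g p.2))

section
variable {n : ℕ}

lemma norm_planeWave (x ξ : EuclideanSpace ℝ (Fin n)) : ‖planeWave x ξ‖ = 1 := by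
  rw [planeWave, Complex.norm_exp]; simp

@[fun_prop]
lemma continuous_planeWave_comp {X : Type*} [TopologicalSpace X]
    {f g : X → EuclideanSpace ℝ (Fin n)} (hf : Continuous f) (hg : Continuous g) :
    Continuous fun x => planeWave (f x) (g x) := by
  unfold planeWave; fun_prop

@[fun_prop]
lemma measurable_planeWave_comp {X : Type*} [MeasurableSpace X]
    {f g : X → EuclideanSpace ℝ (Fin n)} (hf : Measurable f) (hg : Measurable g) :
    Measurable fun x => planeWave (f x) (g x) := by
  unfold planeWave; fun_prop

lemma planeWave_sub (x y ξ : EuclideanSpace ℝ (Fin n)) :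
    planeWave (x - y) ξ = planeWave x ξ * (starRingEnd ℂ) (planeWave y ξ) := by
  simp only [planeWave, ← Complex.exp_conj, ← Complex.exp_add, inner_sub_left]
  congr 1; simp; ring

lemma planeWave_add (x ξ η : EuclideanSpace ℝ (Fin n)) :
    planeWave x (ξ + η) = planeWave x ξ * planeWave x η := by
  simp only [planeWave, ← Complex.exp_add, inner_add_right]
  congr 1; push_cast; ring

lemma integrable_conv {K : EuclideanSpace ℝ (Fin n) → ℂ} (hK : Measurable K) {C : ℝ}
    (hC : ∀ x, ‖K x‖ ≤ C)
    {h g : EuclideanSpace ℝ (Fin n) → ℂ} (hh : Integrable h) (hg : Integrable g) :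
    Integrable (fun p : EuclideanSpace ℝ (Fin n) × EuclideanSpace ℝ (Fin n) =>
      K (p.1 - p.2) * (h p.1 * (starRingEnd ℂ) (g p.2))) := by
  have h1 : Integrable (fun p : EuclideanSpace ℝ (Fin n) × EuclideanSpace ℝ (Fin n) =>
      h p.1 * (starRingEnd ℂ) (g p.2)) (volume.prod volume) :=
    hh.mul_prod (g := fun y => (starRingEnd ℂ) (g y)) (by
      simpa using (Complex.conjCLE.toContinuousLinearMap.integrable_comp hg))
  refine h1.bdd_mul (c := C) ?_ (Filter.Eventually.of_forall fun p => hC _)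
  exact (hK.comp (measurable_fst.sub measurable_snd)).aestronglyMeasurable

/-- If the kernel is the Fourier transform of a finite measure (the image of `μ` under `φ`), the
form is the integral of `ĥ conj ĝ` against that measure. -/
lemma convForm_eq_integral_waveTransform {Ω : Type*} [MeasurableSpace Ω] (μ : Measure Ω)
    [IsFiniteMeasure μ] {φ : Ω → EuclideanSpace ℝ (Fin n)} (hφ : Measurable φ)
    {K : EuclideanSpace ℝ (Fin n) → ℂ} (hK : ∀ x, K x = ∫ ω, planeWave x (φ ω) ∂μ)
    {h g : EuclideanSpace ℝ (Fin n) → ℂ} (hh : Integrable h) (hg : Integrable g) :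
    convForm K h g =
      ∫ ω, waveTransform h (φ ω) * (starRingEnd ℂ) (waveTransform g (φ ω)) ∂μ := by
  have hg' : Integrable (fun y => (starRingEnd ℂ) (g y)) := by
    simpa using (Complex.conjCLE.toContinuousLinearMap.integrable_comp hg)
  have h1 : Integrable (fun p : EuclideanSpace ℝ (Fin n) × EuclideanSpace ℝ (Fin n) =>
      h p.1 * (starRingEnd ℂ) (g p.2)) (volume.prod volume) := hh.mul_prod hg'
  have h2 : Integrable (fun q : (EuclideanSpace ℝ (Fin n) × EuclideanSpace ℝ (Fin n)) × Ω =>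
      planeWave (q.1.1 - q.1.2) (φ q.2) * (h q.1.1 * (starRingEnd ℂ) (g q.1.2)))
      ((volume.prod volume).prod μ) := by
    refine (h1.comp_fst μ).bdd_mul (c := 1) ?_ (Filter.Eventually.of_forall fun p =>
      (norm_planeWave _ _).le)
    exact Measurable.aestronglyMeasurable (by fun_prop)
  have h3 : ∀ ω, waveTransform h (φ ω) * (starRingEnd ℂ) (waveTransform g (φ ω)) =
      ∫ p : EuclideanSpace ℝ (Fin n) × EuclideanSpace ℝ (Fin n),
        planeWave (p.1 - p.2) (φ ω) * (h p.1 * (starRingEnd ℂ) (g p.2)) := by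
    intro ω
    rw [waveTransform, waveTransform, ← integral_conj, ← integral_prod_mul]
    refine integral_congr_ae (Filter.Eventually.of_forall fun p => ?_)
    simp only [planeWave_sub, map_mul]; ring
  simp_rw [h3]
  refine Eq.trans ?_ (integral_integral_swap (f := fun (p : EuclideanSpace ℝ (Fin n) ×
    EuclideanSpace ℝ (Fin n)) ω =>
      planeWave (p.1 - p.2) (φ ω) * (h p.1 * (starRingEnd ℂ) (g p.2))) h2)
  rw [convForm]
  refine integral_congr_ae (Filter.Eventually.of_forall fun p => ?_)
  simp only [hK, integral_mul_const]

/-- Schur's test. The hypothesis on `‖h x‖ * ‖g y‖` is what the inequality between arithmetic and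
geometric mean gives for functions dominated by `(H v)^{1/2}` and `(G v)^{1/2}`. -/
lemma enorm_convForm_le_of_schur {K : EuclideanSpace ℝ (Fin n) → ℂ}
    {k : EuclideanSpace ℝ (Fin n) → ℝ≥0∞} (hk : Measurable k) (hkneg : ∀ x, k (-x) = k x)
    (hKk : ∀ x, ‖K x‖ₑ ≤ k x)
    {h g : EuclideanSpace ℝ (Fin n) → ℂ} {H G v : EuclideanSpace ℝ (Fin n) → ℝ≥0∞}
    (hH : Measurable H) (hG : Measurable G) (hv : Measurable v) {D S : ℝ≥0∞}
    (hD : ∀ x y, ‖h x‖ₑ * ‖g y‖ₑ ≤ D * (H x * v y + G y * v x))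
    (hS : ∀ x, ∫⁻ y, k (x - y) * v y ≤ S) :
    ‖convForm K h g‖ₑ ≤ D * S * ((∫⁻ x, H x) + ∫⁻ x, G x) := by
  have hsub : ∀ {f : EuclideanSpace ℝ (Fin n) × EuclideanSpace ℝ (Fin n) → ℝ≥0∞},
      Measurable f → ∫⁻ p, f p = ∫⁻ x, ∫⁻ y, f (x, y) := fun hf =>
    lintegral_prod _ hf.aemeasurable
  have hsub' : ∀ {f : EuclideanSpace ℝ (Fin n) × EuclideanSpace ℝ (Fin n) → ℝ≥0∞},
      Measurable f → ∫⁻ p, f p = ∫⁻ y, ∫⁻ x, f (x, y) := fun hf =>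
    lintegral_prod_symm _ hf.aemeasurable
  calc ‖convForm K h g‖ₑ
      ≤ ∫⁻ p : EuclideanSpace ℝ (Fin n) × EuclideanSpace ℝ (Fin n),
          ‖K (p.1 - p.2) * (h p.1 * (starRingEnd ℂ) (g p.2))‖ₑ :=
        enorm_integral_le_lintegral_enorm _
    _ ≤ ∫⁻ p : EuclideanSpace ℝ (Fin n) × EuclideanSpace ℝ (Fin n),
          (D * (H p.1 * (k (p.1 - p.2) * v p.2)) + D * (G p.2 * (k (p.2 - p.1) * v p.1))) := by
        refine lintegral_mono fun p => ?_
        have e : k (p.2 - p.1) = k (p.1 - p.2) := by rw [← hkneg, neg_sub]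
        have e2 : ‖(starRingEnd ℂ) (g p.2)‖ₑ = ‖g p.2‖ₑ := by
          rw [← ofReal_norm, ← ofReal_norm, Complex.norm_conj]
        rw [enorm_mul, enorm_mul, e2, e]
        calc _ ≤ k (p.1 - p.2) * (D * (H p.1 * v p.2 + G p.2 * v p.1)) :=
              mul_le_mul' (hKk _) (hD _ _)
          _ = _ := by ring
    _ = D * (∫⁻ x, H x * ∫⁻ y, k (x - y) * v y) + D * (∫⁻ y, G y * ∫⁻ x, k (y - x) * v x) := by
        rw [lintegral_add_left (by fun_prop), hsub (by fun_prop), hsub' (by fun_prop)]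
        congr 1
        · rw [← lintegral_const_mul _ (by fun_prop)]
          refine lintegral_congr fun x => ?_
          rw [← lintegral_const_mul _ (by fun_prop), ← lintegral_const_mul _ (by fun_prop)]
        · rw [← lintegral_const_mul _ (by fun_prop)]
          refine lintegral_congr fun x => ?_
          rw [← lintegral_const_mul _ (by fun_prop), ← lintegral_const_mul _ (by fun_prop)]
    _ ≤ D * (∫⁻ x, H x * S) + D * (∫⁻ y, G y * S) := by
        gcongr with x x
        · exact hS x
        · exact hS x
    _ = D * S * ((∫⁻ x, H x) + ∫⁻ x, G x) := by
        rw [lintegral_mul_const _ hH, lintegral_mul_const _ hG]; ring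

end

/-! ### Gaussians and the Plancherel inequality -/

section
variable {n : ℕ}

lemma ENNReal.mul_le_weighted_sq_add_sq {t : ℝ≥0∞} (ht : t ≠ 0) (ht' : t ≠ ∞) (a b : ℝ≥0∞) :
    a * b ≤ t * a ^ 2 + t⁻¹ * b ^ 2 := by
  rcases le_total (t * a) b with h | h
  · have : a ≤ t⁻¹ * b := by
      calc a = t⁻¹ * (t * a) := by rw [← mul_assoc, ENNReal.inv_mul_cancel ht ht', one_mul]
        _ ≤ _ := by gcongr
    calc a * b ≤ t⁻¹ * b * b := by gcongr
      _ = t⁻¹ * b ^ 2 := by ring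
      _ ≤ _ := le_add_self
  · calc a * b ≤ a * (t * a) := by gcongr
      _ = t * a ^ 2 := by ring
      _ ≤ _ := le_self_add

lemma integral_planeWave_mul_gaussian {b : ℝ} (hb : 0 < b) (x : EuclideanSpace ℝ (Fin n)) :
    ∫ ξ, planeWave x ξ * ((Real.exp (-b * ‖ξ‖ ^ 2) : ℝ) : ℂ) =
      (((Real.pi / b) ^ ((n : ℝ) / 2) * Real.exp (-‖x‖ ^ 2 / (4 * b)) : ℝ) : ℂ) := by
  have h := GaussianFourier.integral_cexp_neg_mul_sq_norm_add (V := EuclideanSpace ℝ (Fin n))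
    (b := (b : ℂ)) (by simpa using hb) (-Complex.I) x
  have e : ∀ ξ : EuclideanSpace ℝ (Fin n), planeWave x ξ * ((Real.exp (-b * ‖ξ‖ ^ 2) : ℝ) : ℂ) =
      Complex.exp (-(b : ℂ) * ‖ξ‖ ^ 2 + -Complex.I * ((inner ℝ x ξ : ℝ) : ℂ)) := by
    intro ξ
    rw [planeWave, Complex.ofReal_exp, ← Complex.exp_add]
    congr 1; push_cast; ring
  simp_rw [e, h]
  rw [finrank_euclideanSpace_fin, Complex.ofReal_mul, Complex.ofReal_cpow (by positivity),
    Complex.ofReal_exp]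
  push_cast
  congr 2
  simp [neg_div]

lemma integrable_gaussian {b : ℝ} (hb : 0 < b) :
    Integrable fun ξ : EuclideanSpace ℝ (Fin n) => Real.exp (-b * ‖ξ‖ ^ 2) := by
  have h := GaussianFourier.integrable_cexp_neg_mul_sq_norm_add (V := EuclideanSpace ℝ (Fin n))
    (b := (b : ℂ)) (by simpa using hb) 0 0
  refine h.norm.congr (Filter.Eventually.of_forall fun ξ => ?_)
  simp [Complex.norm_exp, ← Complex.ofReal_pow]

lemma lintegral_gaussian {b : ℝ} (hb : 0 < b) :
    ∫⁻ ξ : EuclideanSpace ℝ (Fin n), ENNReal.ofReal (Real.exp (-b * ‖ξ‖ ^ 2)) =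
      ENNReal.ofReal ((Real.pi / b) ^ ((n : ℝ) / 2)) := by
  rw [← ofReal_integral_eq_lintegral_ofReal (integrable_gaussian hb)
    (Filter.Eventually.of_forall fun _ => (Real.exp_pos _).le),
    GaussianFourier.integral_rexp_neg_mul_sq_norm hb, finrank_euclideanSpace_fin]

lemma continuous_waveTransform {h : EuclideanSpace ℝ (Fin n) → ℂ} (hh : Integrable h) :
    Continuous (waveTransform h) := by
  refine continuous_of_dominated (bound := fun x => ‖h x‖) (fun ξ => ?_) (fun ξ => ?_) hh.norm ?_
  · exact (Measurable.aestronglyMeasurable (by fun_prop)).mul hh.aestronglyMeasurable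
  · exact Filter.Eventually.of_forall fun x => by rw [norm_mul, norm_planeWave, one_mul]
  · exact Filter.Eventually.of_forall fun x => by fun_prop

lemma norm_waveTransform_le (h : EuclideanSpace ℝ (Fin n) → ℂ) (ξ : EuclideanSpace ℝ (Fin n)) :
    ‖waveTransform h ξ‖ ≤ ∫ x, ‖h x‖ := by
  refine (norm_integral_le_integral_norm _).trans_eq (integral_congr_ae ?_)
  exact Filter.Eventually.of_forall fun x => by simp [norm_planeWave]

lemma enorm_integral_ofReal {X : Type*} [MeasurableSpace X] {μ : Measure X} {r : X → ℝ}
    (hr : Integrable r μ) (h0 : ∀ x, 0 ≤ r x) :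
    ‖∫ x, ((r x : ℝ) : ℂ) ∂μ‖ₑ = ∫⁻ x, ENNReal.ofReal (r x) ∂μ := by
  rw [integral_complex_ofReal, ← ofReal_norm, Complex.norm_real, Real.norm_eq_abs,
    abs_of_nonneg (integral_nonneg h0),
    ofReal_integral_eq_lintegral_ofReal hr (Filter.Eventually.of_forall h0)]

/-- The case `h = g` of `convForm_eq_integral_waveTransform`: the form of a kernel that is the
Fourier transform of a positive measure is an `L²` norm. -/
lemma lintegral_waveTransform_sq_eq_enorm_convForm {Ω : Type*} [MeasurableSpace Ω] (μ : Measure Ω)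
    [IsFiniteMeasure μ] {φ : Ω → EuclideanSpace ℝ (Fin n)} (hφ : Measurable φ)
    {K : EuclideanSpace ℝ (Fin n) → ℂ} (hK : ∀ x, K x = ∫ ω, planeWave x (φ ω) ∂μ)
    {h : EuclideanSpace ℝ (Fin n) → ℂ} (hh : Integrable h) :
    ∫⁻ ω, ‖waveTransform h (φ ω)‖ₑ ^ 2 ∂μ = ‖convForm K h h‖ₑ := by
  rw [convForm_eq_integral_waveTransform μ hφ hK hh hh]
  have hm : Measurable fun ω => waveTransform h (φ ω) :=
    (continuous_waveTransform hh).measurable.comp hφ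
  have hi : Integrable (fun ω => ‖waveTransform h (φ ω)‖ ^ 2) μ := by
    refine (integrable_const ((∫ x, ‖h x‖) ^ 2)).mono' (hm.norm.pow_const 2).aestronglyMeasurable
      (Filter.Eventually.of_forall fun ω => ?_)
    rw [Real.norm_eq_abs, abs_of_nonneg (by positivity)]
    gcongr
    exact norm_waveTransform_le h _
  have e : ∀ ω, waveTransform h (φ ω) * (starRingEnd ℂ) (waveTransform h (φ ω)) =
      ((‖waveTransform h (φ ω)‖ ^ 2 : ℝ) : ℂ) := fun ω => by
    rw [Complex.mul_conj, Complex.normSq_eq_norm_sq]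
  simp_rw [e]
  rw [enorm_integral_ofReal hi fun _ => by positivity]
  refine lintegral_congr fun ω => ?_
  rw [← ofReal_norm, ENNReal.ofReal_pow (norm_nonneg _)]

lemma lintegral_waveTransform_sq_mul_gaussian_le {h : EuclideanSpace ℝ (Fin n) → ℂ}
    (hh : Integrable h) (hm : Measurable h) {ε : ℝ} (hε : 0 < ε) :
    ∫⁻ ξ, ENNReal.ofReal (Real.exp (-ε * ‖ξ‖ ^ 2)) * ‖waveTransform h ξ‖ₑ ^ 2 ≤
      ENNReal.ofReal ((2 * Real.pi) ^ (n : ℝ)) * (2 * ∫⁻ x, ‖h x‖ₑ ^ 2) := by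
  set d : EuclideanSpace ℝ (Fin n) → ℝ := fun ξ => Real.exp (-ε * ‖ξ‖ ^ 2) with hd
  have hdm : Measurable d := by fun_prop
  set μ : Measure (EuclideanSpace ℝ (Fin n)) :=
    volume.withDensity (fun ξ => ENNReal.ofReal (d ξ)) with hμ
  have : IsFiniteMeasure μ := by
    refine isFiniteMeasure_withDensity ?_
    rw [lintegral_gaussian hε]; exact ENNReal.ofReal_ne_top
  set K : EuclideanSpace ℝ (Fin n) → ℂ := fun x =>
    (((Real.pi / ε) ^ ((n : ℝ) / 2) * Real.exp (-‖x‖ ^ 2 / (4 * ε)) : ℝ) : ℂ) with hKdef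
  have hK : ∀ x, K x = ∫ ξ, planeWave x (id ξ) ∂μ := by
    intro x
    rw [hμ, integral_withDensity_eq_integral_toReal_smul (by fun_prop) (by simp)]
    rw [hKdef]
    simp only
    rw [← integral_planeWave_mul_gaussian hε x]
    refine integral_congr_ae (Filter.Eventually.of_forall fun ξ => ?_)
    simp only [id]
    rw [ENNReal.toReal_ofReal (Real.exp_pos _).le, Complex.real_smul, mul_comm]
  have h1 := lintegral_waveTransform_sq_eq_enorm_convForm μ measurable_id hK hh
  simp only [id] at h1
  rw [hμ, lintegral_withDensity_eq_lintegral_mul _ (by fun_prop)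
    ((continuous_waveTransform hh).measurable.enorm.pow_const 2)] at h1
  simp only [Pi.mul_apply] at h1
  rw [h1]
  have hkm : Measurable fun x : EuclideanSpace ℝ (Fin n) => ‖K x‖ₑ := by fun_prop
  have hS : ∀ x : EuclideanSpace ℝ (Fin n), ∫⁻ y, ‖K (x - y)‖ₑ * 1 ≤
      ENNReal.ofReal ((2 * Real.pi) ^ (n : ℝ)) := by
    intro x
    simp only [mul_one]
    rw [lintegral_sub_left_eq_self (fun y => ‖K y‖ₑ) x]
    have e : ∀ y, ‖K y‖ₑ = ENNReal.ofReal ((Real.pi / ε) ^ ((n : ℝ) / 2)) *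
        ENNReal.ofReal (Real.exp (-(1 / (4 * ε)) * ‖y‖ ^ 2)) := by
      intro y
      rw [← ENNReal.ofReal_mul (by positivity), ← ofReal_norm, Complex.norm_real, Real.norm_eq_abs,
        abs_of_nonneg (by positivity)]
      congr 3; ring
    simp_rw [e]
    rw [lintegral_const_mul _ (by fun_prop), lintegral_gaussian (by positivity),
      ← ENNReal.ofReal_mul (by positivity), ← Real.mul_rpow (by positivity) (by positivity)]
    have : Real.pi / ε * (Real.pi / (1 / (4 * ε))) = (2 * Real.pi) ^ (2 : ℝ) := by
      rw [Real.rpow_two]; field_simp; ring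
    rw [this, ← Real.rpow_mul (by positivity)]
    apply le_of_eq
    congr 2; ring
  have := enorm_convForm_le_of_schur (K := K) (k := fun x => ‖K x‖ₑ) hkm
    (fun x => by simp [hKdef]) (fun x => le_rfl) (h := h) (g := h) (H := fun x => ‖h x‖ₑ ^ 2)
    (G := fun x => ‖h x‖ₑ ^ 2) (v := fun _ => 1) (D := 1) (by fun_prop) (by fun_prop)
    measurable_const (fun x y => by
      simpa using ENNReal.mul_le_weighted_sq_add_sq (t := 1) one_ne_zero ENNReal.one_ne_top
        ‖h x‖ₑ ‖h y‖ₑ) hS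
  rw [one_mul, ← two_mul] at this
  exact this

/-- The Plancherel inequality, with a constant that is off by a factor `2`. -/
lemma lintegral_waveTransform_sq_le {h : EuclideanSpace ℝ (Fin n) → ℂ}
    (hh : Integrable h) (hm : Measurable h) :
    ∫⁻ ξ, ‖waveTransform h ξ‖ₑ ^ 2 ≤
      ENNReal.ofReal ((2 * Real.pi) ^ (n : ℝ)) * (2 * ∫⁻ x, ‖h x‖ₑ ^ 2) := by
  have hc := (continuous_waveTransform hh).measurable
  have hlim : Filter.Tendsto (fun k : ℕ => ∫⁻ ξ,
      ENNReal.ofReal (Real.exp (-(1 / ((k : ℝ) + 1)) * ‖ξ‖ ^ 2)) * ‖waveTransform h ξ‖ₑ ^ 2)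
      Filter.atTop (nhds (∫⁻ ξ, ‖waveTransform h ξ‖ₑ ^ 2)) := by
    refine lintegral_tendsto_of_tendsto_of_monotone (fun k => by fun_prop) ?_ ?_
    · refine Filter.Eventually.of_forall fun ξ i j hij => ?_
      simp only
      gcongr
    · refine Filter.Eventually.of_forall fun ξ => ?_
      have h1 : Filter.Tendsto (fun k : ℕ => Real.exp (-(1 / ((k : ℝ) + 1)) * ‖ξ‖ ^ 2))
          Filter.atTop (nhds 1) := by
        have := ((tendsto_one_div_add_atTop_nhds_zero_nat (𝕜 := ℝ)).neg.mul_const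
          (‖ξ‖ ^ 2)).rexp
        simpa using this
      have h2 := ENNReal.tendsto_ofReal h1
      have h3 := ENNReal.Tendsto.mul_const (b := ‖waveTransform h ξ‖ₑ ^ 2) h2 (Or.inl (by simp))
      simpa using h3
  exact le_of_tendsto' hlim fun k =>
    lintegral_waveTransform_sq_mul_gaussian_le hh hm (by positivity)

end

/-! ### Polar coordinates and Gaussian averages over the sphere -/

section
variable {n : ℕ}

/-- Polar coordinates for nonnegative functions. -/
lemma lintegral_eq_lintegral_sphere (hn : 1 ≤ n) {F : EuclideanSpace ℝ (Fin n) → ℝ≥0∞}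
    (hF : Measurable F) :
    ∫⁻ x, F x = ∫⁻ ω, (∫⁻ s in Set.Ioi (0 : ℝ), ENNReal.ofReal (s ^ (n - 1)) *
      F (s • (ω : EuclideanSpace ℝ (Fin n)))) ∂(surfaceMeasure n) := by
  have : Nontrivial (EuclideanSpace ℝ (Fin n)) :=
    Module.nontrivial_of_finrank_pos (R := ℝ) (by rw [finrank_euclideanSpace_fin]; omega)
  have hmp :=
    (volume : Measure (EuclideanSpace ℝ (Fin n))).measurePreserving_homeomorphUnitSphereProd
  set f : Metric.sphere (0 : EuclideanSpace ℝ (Fin n)) 1 × Set.Ioi (0 : ℝ) → ℝ≥0∞ :=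
    fun p => F ((p.2 : ℝ) • (p.1 : EuclideanSpace ℝ (Fin n))) with hf
  have hfm : Measurable f := by fun_prop
  have h1 := hmp.lintegral_comp hfm
  have h2 : ∀ a : ({0}ᶜ : Set (EuclideanSpace ℝ (Fin n))),
      f (homeomorphUnitSphereProd (EuclideanSpace ℝ (Fin n)) a) = F a := by
    intro a
    have := congrArg Subtype.val
      ((homeomorphUnitSphereProd (EuclideanSpace ℝ (Fin n))).symm_apply_apply a)
    rw [hf]; simp only
    rw [← homeomorphUnitSphereProd_symm_apply_coe, this]
  simp_rw [h2] at h1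
  rw [lintegral_subtype_comap (measurableSet_singleton _).compl, restrict_compl_singleton] at h1
  rw [h1, lintegral_prod _ hfm.aemeasurable]
  refine lintegral_congr fun ω => ?_
  rw [Measure.volumeIoiPow, lintegral_withDensity_eq_lintegral_mul _ (by fun_prop) (by fun_prop),
    finrank_euclideanSpace_fin]
  exact lintegral_subtype_comap measurableSet_Ioi
    (fun s : ℝ => ENNReal.ofReal (s ^ (n - 1)) * F (s • (ω : EuclideanSpace ℝ (Fin n))))

/-- Polar coordinates for integrable functions, with the radius as the outer variable. -/
lemma integral_eq_integral_sphere (hn : 1 ≤ n) {F : EuclideanSpace ℝ (Fin n) → ℂ}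
    (hF : Integrable F) :
    ∫ x, F x = ∫ s in Set.Ioi (0 : ℝ), ((s ^ (n - 1) : ℝ) : ℂ) *
      ∫ ω, F (s • (ω : EuclideanSpace ℝ (Fin n))) ∂(surfaceMeasure n) := by
  have : Nontrivial (EuclideanSpace ℝ (Fin n)) :=
    Module.nontrivial_of_finrank_pos (R := ℝ) (by rw [finrank_euclideanSpace_fin]; omega)
  have hmp :=
    (volume : Measure (EuclideanSpace ℝ (Fin n))).measurePreserving_homeomorphUnitSphereProd
  have hemb := (homeomorphUnitSphereProd (EuclideanSpace ℝ (Fin n))).measurableEmbedding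
  set f : Metric.sphere (0 : EuclideanSpace ℝ (Fin n)) 1 × Set.Ioi (0 : ℝ) → ℂ :=
    fun p => F ((p.2 : ℝ) • (p.1 : EuclideanSpace ℝ (Fin n))) with hf
  have h2 : f ∘ (homeomorphUnitSphereProd (EuclideanSpace ℝ (Fin n))) =
      fun a : ({0}ᶜ : Set (EuclideanSpace ℝ (Fin n))) => F a := by
    funext a
    have := congrArg Subtype.val
      ((homeomorphUnitSphereProd (EuclideanSpace ℝ (Fin n))).symm_apply_apply a)
    simp only [hf, Function.comp]
    rw [← homeomorphUnitSphereProd_symm_apply_coe, this]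
  have h1 := hmp.integral_comp hemb f
  have hint := hmp.integrable_comp_emb hemb (g := f)
  rw [h2] at hint
  have hF' : Integrable (fun a : ({0}ᶜ : Set (EuclideanSpace ℝ (Fin n))) => F a)
      (Measure.comap Subtype.val volume) := by
    have := (MeasurableEmbedding.subtype_coe (measurableSet_singleton (0 :
      EuclideanSpace ℝ (Fin n))).compl).integrableOn_range_iff_comap (f := F) (μ := volume)
    exact this.1 hF.integrableOn
  have h3 := integral_prod_symm f (hint.1 hF')
  have h4 : ∀ a, f (homeomorphUnitSphereProd (EuclideanSpace ℝ (Fin n)) a) = F a :=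
    fun a => congrFun h2 a
  simp_rw [h4] at h1
  rw [integral_subtype_comap (measurableSet_singleton _).compl, restrict_compl_singleton] at h1
  rw [h1, h3, Measure.volumeIoiPow,
    integral_withDensity_eq_integral_toReal_smul (by fun_prop) (by simp),
    finrank_euclideanSpace_fin, ← integral_subtype_comap measurableSet_Ioi
    (fun s : ℝ => ((s ^ (n - 1) : ℝ) : ℂ) *
      ∫ ω, F (s • (ω : EuclideanSpace ℝ (Fin n))) ∂(surfaceMeasure n))]
  refine integral_congr_ae (Filter.Eventually.of_forall fun s => ?_)
  have hs : (0 : ℝ) < s := s.2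
  simp only [hf]
  rw [ENNReal.toReal_ofReal (by positivity), Complex.real_smul]
  rfl

instance : IsFiniteMeasure (surfaceMeasure n) := by unfold surfaceMeasure; infer_instance

/-- A Gaussian of width `a^{-1/2}` has mass at most of order `a^{-(n-1)/2}` on the sphere: fattening
the sphere to a shell of thickness `a^{-1/2}` bounds it by the integral over all of `ℝⁿ`. -/
lemma lintegral_sphere_gaussian_le (hn : 1 ≤ n) {a : ℝ} (ha : 0 < a)
    (ξ : EuclideanSpace ℝ (Fin n)) :
    ∫⁻ ω, ENNReal.ofReal (Real.exp (-a * ‖ξ - (ω : EuclideanSpace ℝ (Fin n))‖ ^ 2))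
      ∂(surfaceMeasure n) ≤
      ENNReal.ofReal (Real.exp 1 * (2 * Real.pi) ^ ((n : ℝ) / 2) * a ^ (-(((n : ℝ) - 1) / 2))) := by
  set r : ℝ := a ^ (-(1 / 2) : ℝ) with hr
  have hr0 : 0 < r := by positivity
  have hr2 : a * r ^ 2 = 1 := by
    rw [hr, ← Real.rpow_natCast, ← Real.rpow_mul ha.le]; norm_num
    rw [Real.rpow_neg_one]; field_simp
  have key : ∀ (ω : Metric.sphere (0 : EuclideanSpace ℝ (Fin n)) 1),
      ENNReal.ofReal (Real.exp (-a * ‖ξ - (ω : EuclideanSpace ℝ (Fin n))‖ ^ 2)) *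
        ENNReal.ofReal r ≤
      ∫⁻ s in Set.Ioi (0 : ℝ), ENNReal.ofReal (s ^ (n - 1)) *
        (ENNReal.ofReal (Real.exp 1) * ENNReal.ofReal (Real.exp (-(a / 2) *
          ‖s • (ω : EuclideanSpace ℝ (Fin n)) - ξ‖ ^ 2))) := by
    intro ω
    have hω : ‖(ω : EuclideanSpace ℝ (Fin n))‖ = 1 := by simp
    calc _ = ∫⁻ s in Set.Ioo (1 : ℝ) (1 + r),
          ENNReal.ofReal (Real.exp (-a * ‖ξ - (ω : EuclideanSpace ℝ (Fin n))‖ ^ 2)) := by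
          rw [lintegral_const, Measure.restrict_apply_univ, Real.volume_Ioo]; simp
      _ ≤ ∫⁻ s in Set.Ioo (1 : ℝ) (1 + r), ENNReal.ofReal (s ^ (n - 1)) *
        (ENNReal.ofReal (Real.exp 1) * ENNReal.ofReal (Real.exp (-(a / 2) *
          ‖s • (ω : EuclideanSpace ℝ (Fin n)) - ξ‖ ^ 2))) := by
          refine setLIntegral_mono' measurableSet_Ioo fun s hs => ?_
          rw [← ENNReal.ofReal_mul (Real.exp_pos _).le, ← ENNReal.ofReal_mul
            (pow_nonneg (by linarith [hs.1]) _), ← Real.exp_add]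
          apply ENNReal.ofReal_le_ofReal
          have h1 : (1 : ℝ) ≤ s ^ (n - 1) := one_le_pow₀ hs.1.le
          have h2 : ‖s • (ω : EuclideanSpace ℝ (Fin n)) - ξ‖ ≤
              ‖ξ - (ω : EuclideanSpace ℝ (Fin n))‖ + r := by
            have e : s • (ω : EuclideanSpace ℝ (Fin n)) - ξ =
                (s - 1) • (ω : EuclideanSpace ℝ (Fin n)) - (ξ - ω) := by
              rw [sub_smul, one_smul]; abel
            rw [e]
            refine (norm_sub_le _ _).trans ?_
            rw [norm_smul, hω, Real.norm_eq_abs, abs_of_pos (by linarith [hs.1])]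
            linarith [hs.2]
          have h3 : ‖s • (ω : EuclideanSpace ℝ (Fin n)) - ξ‖ ^ 2 ≤
              2 * ‖ξ - (ω : EuclideanSpace ℝ (Fin n))‖ ^ 2 + 2 * r ^ 2 := by
            nlinarith [norm_nonneg (s • (ω : EuclideanSpace ℝ (Fin n)) - ξ),
              sq_nonneg (‖ξ - (ω : EuclideanSpace ℝ (Fin n))‖ - r)]
          refine le_trans ?_ (le_mul_of_one_le_left (Real.exp_pos _).le h1)
          apply Real.exp_le_exp.2
          nlinarith
      _ ≤ _ := lintegral_mono_set fun s hs => lt_trans one_pos hs.1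
  have h1 : (∫⁻ ω, ENNReal.ofReal (Real.exp (-a * ‖ξ - (ω : EuclideanSpace ℝ (Fin n))‖ ^ 2))
      ∂(surfaceMeasure n)) * ENNReal.ofReal r ≤
      ENNReal.ofReal (Real.exp 1) * ENNReal.ofReal ((Real.pi / (a / 2)) ^ ((n : ℝ) / 2)) := by
    rw [← lintegral_mul_const _ (by fun_prop)]
    refine (lintegral_mono key).trans ?_
    rw [← lintegral_eq_lintegral_sphere hn (F := fun y => ENNReal.ofReal (Real.exp 1) *
      ENNReal.ofReal (Real.exp (-(a / 2) * ‖y - ξ‖ ^ 2))) (by fun_prop),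
      lintegral_const_mul _ (by fun_prop),
      lintegral_sub_right_eq_self (fun y : EuclideanSpace ℝ (Fin n) =>
        ENNReal.ofReal (Real.exp (-(a / 2) * ‖y‖ ^ 2))) ξ, lintegral_gaussian (by positivity)]
  rw [← ENNReal.le_div_iff_mul_le (Or.inl (by simpa using hr0)) (Or.inl ENNReal.ofReal_ne_top),
    ← ENNReal.ofReal_mul (Real.exp_pos _).le, ← ENNReal.ofReal_div_of_pos hr0] at h1
  refine h1.trans_eq ?_
  congr 1
  have : Real.pi / (a / 2) = (2 * Real.pi) * a ^ (-1 : ℝ) := by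
    rw [Real.rpow_neg_one]; field_simp
  rw [this, Real.mul_rpow (by positivity) (by positivity), ← Real.rpow_mul ha.le, hr,
    mul_div_assoc, mul_div_assoc, ← Real.rpow_sub ha, mul_assoc]
  congr 3; ring

end

/-! ### The `L²` bound for the low part of the kernel -/

section
variable {n : ℕ}

lemma fourierSphere_one_eq (x : EuclideanSpace ℝ (Fin n)) :
    fourierSphere (fun _ => 1) x =
      ∫ ω, planeWave x (ω : EuclideanSpace ℝ (Fin n)) ∂(surfaceMeasure n) := by
  simp only [fourierSphere, mul_one]; rfl

lemma continuous_fourierSphere {f : Metric.sphere (0 : EuclideanSpace ℝ (Fin n)) 1 → ℂ}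
    (hf : Integrable f (surfaceMeasure n)) : Continuous (fourierSphere f) := by
  refine continuous_of_dominated (bound := fun x => ‖f x‖) (fun ξ => ?_) (fun ξ => ?_) hf.norm ?_
  · exact (Measurable.aestronglyMeasurable (by fun_prop)).mul hf.aestronglyMeasurable
  · exact Filter.Eventually.of_forall fun ω => by
      rw [norm_mul]; simp [Complex.norm_exp]
  · exact Filter.Eventually.of_forall fun ω => by fun_prop

lemma norm_fourierSphere_one_le (x : EuclideanSpace ℝ (Fin n)) :
    ‖fourierSphere (fun _ => 1) x‖ ≤ (surfaceMeasure n).real Set.univ := by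
  rw [fourierSphere_one_eq]
  refine (norm_integral_le_integral_norm _).trans_eq ?_
  simp [norm_planeWave]

/-- Convolution with `σ̂(x) e^{-b|x|²}` is bounded on `L²` with norm of order `b^{-1/2}`: it is the
Fourier multiplier given by the average of a Gaussian of width `b^{1/2}` and mass one over the
sphere. -/
theorem exists_enorm_convForm_gaussian_le (hn : 1 ≤ n) : ∃ C : ℝ, 0 < C ∧ ∀ b : ℝ, 0 < b →
    ∀ t : ℝ≥0∞, t ≠ 0 → t ≠ ∞ → ∀ h g : EuclideanSpace ℝ (Fin n) → ℂ,
      Integrable h → Measurable h → Integrable g → Measurable g →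
      ‖convForm (fun x => fourierSphere (fun _ => 1) x * ((Real.exp (-b * ‖x‖ ^ 2) : ℝ) : ℂ)) h g‖ₑ
        ≤ ENNReal.ofReal (C * b ^ (-(1 / 2) : ℝ)) *
          (t * (∫⁻ x, ‖h x‖ₑ ^ 2) + t⁻¹ * ∫⁻ x, ‖g x‖ₑ ^ 2) := by
  set C₀ : ℝ := (4 * Real.pi) ^ (-((n : ℝ) / 2)) *
    (Real.exp 1 * (2 * Real.pi) ^ ((n : ℝ) / 2) * 4 ^ (((n : ℝ) - 1) / 2)) with hC₀
  refine ⟨C₀ * ((2 * Real.pi) ^ (n : ℝ) * 2), by positivity, ?_⟩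
  intro b hb t ht ht' h g hh hhm hg hgm
  set γ : EuclideanSpace ℝ (Fin n) → ℝ := fun ξ =>
    (4 * Real.pi * b) ^ (-((n : ℝ) / 2)) * Real.exp (-(1 / (4 * b)) * ‖ξ‖ ^ 2) with hγ
  have hγ0 : ∀ ξ, 0 ≤ γ ξ := fun ξ => by positivity
  have hγm : Measurable γ := by fun_prop
  set ν : Measure (EuclideanSpace ℝ (Fin n)) :=
    volume.withDensity (fun ξ => ENNReal.ofReal (γ ξ)) with hν
  have : IsFiniteMeasure ν := by
    refine isFiniteMeasure_withDensity ?_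
    simp_rw [hγ, ENNReal.ofReal_mul (show 0 ≤ (4 * Real.pi * b) ^ (-((n : ℝ) / 2)) by positivity)]
    rw [lintegral_const_mul _ (by fun_prop), lintegral_gaussian (by positivity)]
    exact ENNReal.mul_ne_top ENNReal.ofReal_ne_top ENNReal.ofReal_ne_top
  have hmeas : Measurable fun p : EuclideanSpace ℝ (Fin n) ×
      Metric.sphere (0 : EuclideanSpace ℝ (Fin n)) 1 => p.1 + (p.2 : EuclideanSpace ℝ (Fin n)) := by
    fun_prop
  have hK : ∀ x, fourierSphere (fun _ => 1) x * ((Real.exp (-b * ‖x‖ ^ 2) : ℝ) : ℂ) =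
      ∫ p : EuclideanSpace ℝ (Fin n) × Metric.sphere (0 : EuclideanSpace ℝ (Fin n)) 1,
        planeWave x (p.1 + (p.2 : EuclideanSpace ℝ (Fin n))) ∂(ν.prod (surfaceMeasure n)) := by
    intro x
    simp_rw [planeWave_add]
    rw [integral_prod_mul (fun ξ => planeWave x ξ)
      (fun ω : Metric.sphere (0 : EuclideanSpace ℝ (Fin n)) 1 => planeWave x ω),
      fourierSphere_one_eq, mul_comm]
    congr 1
    rw [hν, integral_withDensity_eq_integral_toReal_smul (by fun_prop) (by simp)]
    have e : ∀ ξ, (ENNReal.ofReal (γ ξ)).toReal • planeWave x ξ =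
        (((4 * Real.pi * b) ^ (-((n : ℝ) / 2)) : ℝ) : ℂ) *
          (planeWave x ξ * ((Real.exp (-(1 / (4 * b)) * ‖ξ‖ ^ 2) : ℝ) : ℂ)) := by
      intro ξ
      rw [ENNReal.toReal_ofReal (hγ0 ξ), hγ, Complex.real_smul]
      push_cast; ring
    simp_rw [e]
    rw [integral_const_mul, integral_planeWave_mul_gaussian (by positivity), ← Complex.ofReal_mul]
    congr 1
    have h1 : Real.pi / (1 / (4 * b)) = 4 * Real.pi * b := by field_simp
    rw [h1, ← mul_assoc, ← Real.rpow_add (by positivity)]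
    simp only [neg_add_cancel, Real.rpow_zero, one_mul]
    congr 1; field_simp
  rw [convForm_eq_integral_waveTransform _ hmeas hK hh hg]
  set G : EuclideanSpace ℝ (Fin n) → ℝ≥0∞ := fun ξ =>
    t * ‖waveTransform h ξ‖ₑ ^ 2 + t⁻¹ * ‖waveTransform g ξ‖ₑ ^ 2 with hG
  have hch := (continuous_waveTransform hh).measurable
  have hcg := (continuous_waveTransform hg).measurable
  have hGm : Measurable G := by fun_prop
  have hM : ∀ η : EuclideanSpace ℝ (Fin n),
      ∫⁻ ω, ENNReal.ofReal (γ (η - (ω : EuclideanSpace ℝ (Fin n)))) ∂(surfaceMeasure n) ≤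
        ENNReal.ofReal (C₀ * b ^ (-(1 / 2) : ℝ)) := by
    intro η
    simp_rw [hγ, ENNReal.ofReal_mul (show 0 ≤ (4 * Real.pi * b) ^ (-((n : ℝ) / 2)) by positivity)]
    rw [lintegral_const_mul _ (by fun_prop)]
    refine (mul_le_mul_right (lintegral_sphere_gaussian_le hn (a := 1 / (4 * b)) (by positivity) η)
      _).trans_eq ?_
    rw [← ENNReal.ofReal_mul (by positivity)]
    congr 1
    rw [hC₀, Real.mul_rpow (by positivity) hb.le, one_div, Real.inv_rpow (by positivity),
      ← Real.rpow_neg (by positivity), neg_neg, Real.mul_rpow (by positivity) hb.le]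
    have : b ^ (-((n : ℝ) / 2)) * b ^ (((n : ℝ) - 1) / 2) = b ^ (-(1 / 2) : ℝ) := by
      rw [← Real.rpow_add hb]; congr 1; ring
    rw [← this]; ring
  calc _ ≤ ∫⁻ p : EuclideanSpace ℝ (Fin n) × Metric.sphere (0 : EuclideanSpace ℝ (Fin n)) 1,
        G (p.1 + (p.2 : EuclideanSpace ℝ (Fin n))) ∂(ν.prod (surfaceMeasure n)) := by
        refine (enorm_integral_le_lintegral_enorm _).trans (lintegral_mono fun p => ?_)
        rw [enorm_mul, RCLike.enorm_conj]
        exact ENNReal.mul_le_weighted_sq_add_sq ht ht' _ _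
    _ = ∫⁻ ω, (∫⁻ η, ENNReal.ofReal (γ (η - (ω : EuclideanSpace ℝ (Fin n)))) * G η)
          ∂(surfaceMeasure n) := by
        rw [lintegral_prod_symm _ (by fun_prop)]
        refine lintegral_congr fun ω => ?_
        rw [hν, lintegral_withDensity_eq_lintegral_mul _ (by fun_prop) (by fun_prop)]
        rw [← lintegral_add_right_eq_self (fun η => ENNReal.ofReal
          (γ (η - (ω : EuclideanSpace ℝ (Fin n)))) * G η) (ω : EuclideanSpace ℝ (Fin n))]
        simp
    _ = ∫⁻ η, (∫⁻ ω, ENNReal.ofReal (γ (η - (ω : EuclideanSpace ℝ (Fin n))))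
          ∂(surfaceMeasure n)) * G η := by
        rw [lintegral_lintegral_swap (by fun_prop)]
        refine lintegral_congr fun η => ?_
        rw [lintegral_mul_const _ (by fun_prop)]
    _ ≤ ∫⁻ η, ENNReal.ofReal (C₀ * b ^ (-(1 / 2) : ℝ)) * G η := by
        gcongr with η; exact hM η
    _ = ENNReal.ofReal (C₀ * b ^ (-(1 / 2) : ℝ)) * (t * (∫⁻ ξ, ‖waveTransform h ξ‖ₑ ^ 2) +
          t⁻¹ * ∫⁻ ξ, ‖waveTransform g ξ‖ₑ ^ 2) := by
        rw [lintegral_const_mul _ hGm, hG, lintegral_add_left (by fun_prop),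
          lintegral_const_mul _ (by fun_prop), lintegral_const_mul _ (by fun_prop)]
    _ ≤ ENNReal.ofReal (C₀ * b ^ (-(1 / 2) : ℝ)) *
          (t * (ENNReal.ofReal ((2 * Real.pi) ^ (n : ℝ)) * (2 * ∫⁻ x, ‖h x‖ₑ ^ 2)) +
          t⁻¹ * (ENNReal.ofReal ((2 * Real.pi) ^ (n : ℝ)) * (2 * ∫⁻ x, ‖g x‖ₑ ^ 2))) := by
        gcongr
        · exact lintegral_waveTransform_sq_le hh hhm
        · exact lintegral_waveTransform_sq_le hg hgm
    _ = _ := by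
        rw [show C₀ * ((2 * Real.pi) ^ (n : ℝ) * 2) * b ^ (-(1 / 2) : ℝ) =
          (C₀ * b ^ (-(1 / 2) : ℝ)) * ((2 * Real.pi) ^ (n : ℝ) * 2) by ring,
          ENNReal.ofReal_mul (p := C₀ * b ^ (-(1 / 2) : ℝ)) (by positivity),
          ENNReal.ofReal_mul (p := (2 * Real.pi) ^ (n : ℝ)) (by positivity)]
        simp only [ENNReal.ofReal_ofNat]
        ring

end

/-! ### Decay of a one-dimensional oscillatory integral -/

section
open Complex Filter Topology

/-- The Poisson-type integrand `z^j e^{iλz} (1 - z²)^μ`, holomorphic in the open half strip above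
`[-1, 1]` and continuous on its closure. -/
noncomputable def poissonIntegrand (j : ℕ) (μ L : ℝ) (z : ℂ) : ℂ :=
  z ^ j * Complex.exp (Complex.I * L * z) * (1 - z ^ 2) ^ (μ : ℂ)

lemma one_sub_sq_re (x y : ℝ) : (1 - ((x : ℂ) + y * I) ^ 2).re = 1 - x ^ 2 + y ^ 2 := by
  simp [pow_two]; ring

lemma norm_poissonIntegrand {j : ℕ} {μ L : ℝ} (z : ℂ) :
    ‖poissonIntegrand j μ L z‖ = ‖z‖ ^ j * Real.exp (-(L * z.im)) * ‖1 - z ^ 2‖ ^ μ := by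
  rw [poissonIntegrand, norm_mul, norm_mul, norm_pow, Complex.norm_exp,
    Complex.norm_cpow_real]
  simp

/-- Cauchy's theorem on the rectangle `[-1, 1] × [0, T]`. -/
lemma poissonIntegrand_rect {j : ℕ} {μ L T : ℝ} (hμ : 0 < μ) :
    (∫ x : ℝ in (-1)..1, poissonIntegrand j μ L x) =
      (∫ x : ℝ in (-1)..1, poissonIntegrand j μ L (x + T * I)) -
      I * (∫ y : ℝ in 0..T, poissonIntegrand j μ L (1 + y * I)) +
      I * (∫ y : ℝ in 0..T, poissonIntegrand j μ L (-1 + y * I)) := by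
  have h := Complex.integral_boundary_rect_eq_zero_of_continuousOn_of_differentiableOn
    (poissonIntegrand j μ L) (-1 : ℝ) (1 + T * I) ?_ ?_
  · simp only [ofReal_re, ofReal_im, add_re, one_re, mul_re, I_re, mul_zero, I_im, mul_one,
      sub_self, add_zero, add_im, one_im, mul_im, zero_add, ofReal_zero, zero_mul, smul_eq_mul,
      ofReal_neg, ofReal_one, neg_re, neg_im,
      neg_zero] at h
    linear_combination h
  · intro z hz
    have hz1 : z.re ∈ Set.Icc (-1 : ℝ) 1 := by
      have := hz.1; simpa [Set.uIcc_of_le] using this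
    have hre : 0 ≤ (1 - z ^ 2).re := by
      have := one_sub_sq_re z.re z.im
      rw [re_add_im] at this
      rw [this]
      nlinarith [hz1.1, hz1.2, sq_nonneg z.im]
    have hc := Complex.continuousAt_cpow_const_of_re_pos (z := 1 - z ^ 2) (w := (μ : ℂ))
      (Or.inl hre) (by simpa using hμ)
    have hc2 : ContinuousAt (fun z : ℂ => (1 - z ^ 2) ^ (μ : ℂ)) z :=
      ContinuousAt.comp (f := fun z : ℂ => 1 - z ^ 2) hc (by fun_prop)
    unfold poissonIntegrand
    refine ContinuousAt.continuousWithinAt ?_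
    exact ContinuousAt.mul (by fun_prop) hc2
  · intro z hz
    have hz1 : z.re ∈ Set.Ioo (-1 : ℝ) 1 := by
      have := hz.1; simpa using this
    have hre : 0 < (1 - z ^ 2).re := by
      have := one_sub_sq_re z.re z.im
      rw [re_add_im] at this
      rw [this]
      nlinarith [hz1.1, hz1.2, sq_nonneg z.im]
    unfold poissonIntegrand
    refine DifferentiableAt.differentiableWithinAt ?_
    refine DifferentiableAt.mul (by fun_prop) ?_
    exact DifferentiableAt.cpow_const (by fun_prop) (Or.inl hre)

/-- On the vertical sides `±1 + i y` the integrand is dominated by a Gamma integrand. -/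
lemma exists_norm_poissonIntegrand_side_le {μ : ℝ} (hμ : 0 < μ) : ∃ C : ℝ, 0 < C ∧
    ∀ j : ℕ, j ≤ 1 → ∀ L : ℝ, 1 ≤ L → ∀ y : ℝ, 0 ≤ y → ∀ e : ℝ, e ^ 2 = 1 →
      ‖poissonIntegrand j μ L (e + y * I)‖ ≤ C * (y ^ μ * Real.exp (-(L / 2 * y))) := by
  obtain ⟨N, hN⟩ := exists_nat_ge μ
  -- `(2 + y)^(N + 1) ≤ C e^{y/2}`
  obtain ⟨C, hC0, hC⟩ : ∃ C : ℝ, 0 < C ∧ ∀ y : ℝ, 0 ≤ y → (2 + y) ^ (N + 1) ≤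
      C * Real.exp (y / 2) := by
    refine ⟨((N + 1).factorial : ℝ) * 2 ^ (N + 1) * Real.exp 1, by positivity, fun y hy => ?_⟩
    have h := Real.pow_div_factorial_le_exp (x := (2 + y) / 2) (by positivity) (N + 1)
    rw [div_le_iff₀ (by positivity), div_pow, div_le_iff₀ (by positivity)] at h
    refine h.trans_eq ?_
    rw [show (2 + y) / 2 = 1 + y / 2 by ring, Real.exp_add]; ring
  refine ⟨C, hC0, ?_⟩
  intro j hj L hL y hy e he
  rw [norm_poissonIntegrand]
  have he1 : |e| = 1 := by
    rw [← sq_abs] at he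
    nlinarith [abs_nonneg e]
  have h1 : ‖(e : ℂ) + y * I‖ ≤ 2 + y := by
    refine (norm_add_le _ _).trans ?_
    simp [he1, abs_of_nonneg hy]
  have h1' : ‖(e : ℂ) + y * I‖ ^ j ≤ 2 + y := by
    interval_cases j
    · simp; linarith
    · simpa using h1
  have h2 : ‖1 - ((e : ℂ) + y * I) ^ 2‖ ≤ y * (2 + y) := by
    have hec : (e : ℂ) ^ 2 = 1 := by exact_mod_cast congrArg (fun x : ℝ => (x : ℂ)) he
    have : 1 - ((e : ℂ) + y * I) ^ 2 = y * (y - 2 * e * I) := by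
      have hI : (I : ℂ) ^ 2 = -1 := I_sq
      linear_combination -hec - (y : ℂ) ^ 2 * hI
    rw [this, norm_mul, norm_real, Real.norm_eq_abs, abs_of_nonneg hy]
    gcongr
    refine (norm_sub_le _ _).trans ?_
    simp [he1, abs_of_nonneg hy]; linarith
  have h3 : ‖1 - ((e : ℂ) + y * I) ^ 2‖ ^ μ ≤ y ^ μ * (2 + y) ^ N := by
    refine (Real.rpow_le_rpow (norm_nonneg _) h2 hμ.le).trans ?_
    rw [Real.mul_rpow hy (by positivity)]
    gcongr
    rw [← Real.rpow_natCast]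
    exact Real.rpow_le_rpow_of_exponent_le (by linarith) hN
  have him : ((e : ℂ) + y * I).im = y := by simp
  rw [him]
  calc _ ≤ (2 + y) * Real.exp (-(L * y)) * (y ^ μ * (2 + y) ^ N) := by gcongr
    _ = (2 + y) ^ (N + 1) * (y ^ μ * Real.exp (-(L * y))) := by ring
    _ ≤ C * Real.exp (y / 2) * (y ^ μ * Real.exp (-(L * y))) := by
        gcongr; exact hC y hy
    _ = C * (y ^ μ * Real.exp (y / 2 - L * y)) := by
        rw [sub_eq_add_neg, Real.exp_add]; ring
    _ ≤ _ := by
        gcongr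
        nlinarith

/-- Decay of order `λ^{-(μ+1)}`, by moving the path of integration to the half lines
`±1 + i[0, ∞)`, where `e^{iλz}` decays. -/
theorem exists_norm_integral_poissonIntegrand_le {μ : ℝ} (hμ : 0 < μ) : ∃ C : ℝ, 0 < C ∧
    ∀ j : ℕ, j ≤ 1 → ∀ L : ℝ, 1 ≤ L →
      ‖∫ x : ℝ in (-1)..1, poissonIntegrand j μ L x‖ ≤ C * L ^ (-(μ + 1)) := by
  obtain ⟨C, hC0, hC⟩ := exists_norm_poissonIntegrand_side_le hμ
  refine ⟨2 * (C * (2 ^ (μ + 1) * Real.Gamma (μ + 1))), by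
    have := Real.Gamma_pos_of_pos (show 0 < μ + 1 by linarith); positivity, ?_⟩
  intro j hj L hL
  have hL0 : 0 < L := by linarith
  set B : ℝ := C * (2 ^ (μ + 1) * Real.Gamma (μ + 1)) * L ^ (-(μ + 1)) with hB
  have hgam : ∫ y in Set.Ioi (0 : ℝ), C * (y ^ μ * Real.exp (-(L / 2 * y))) = B := by
    rw [integral_const_mul]
    have := Real.integral_rpow_mul_exp_neg_mul_Ioi (a := μ + 1) (r := L / 2) (by linarith)
      (by positivity)
    simp only [add_sub_cancel_right] at this
    rw [this, hB, one_div, inv_div, Real.div_rpow (by norm_num) hL0.le, Real.rpow_neg hL0.le]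
    ring
  have hint : IntegrableOn (fun y : ℝ => C * (y ^ μ * Real.exp (-(L / 2 * y))))
      (Set.Ioi 0) := by
    have := integrableOn_rpow_mul_exp_neg_mul_rpow (p := 1) (s := μ) (b := L / 2) (by linarith)
      one_pos (by positivity)
    refine (this.congr_fun (fun y _ => ?_) measurableSet_Ioi).const_mul C
    simp
  have hside : ∀ e : ℝ, e ^ 2 = 1 → ∀ T : ℝ, 0 < T →
      ‖∫ y : ℝ in 0..T, poissonIntegrand j μ L (e + y * I)‖ ≤ B := by
    intro e he T hT
    rw [← hgam]
    refine (intervalIntegral.norm_integral_le_of_norm_le hT.le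
      (g := fun y => C * (y ^ μ * Real.exp (-(L / 2 * y)))) ?_ ?_).trans ?_
    · exact Filter.Eventually.of_forall fun y hy => hC j hj L hL y hy.1.le e he
    · rw [intervalIntegrable_iff_integrableOn_Ioc_of_le hT.le]
      exact hint.mono_set Set.Ioc_subset_Ioi_self
    · rw [intervalIntegral.integral_of_le hT.le]
      refine setIntegral_mono_set hint ?_ (Filter.Eventually.of_forall Set.Ioc_subset_Ioi_self)
      refine (ae_restrict_iff' measurableSet_Ioi).2 (Filter.Eventually.of_forall fun y hy => ?_)
      have : (0 : ℝ) < y := hy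
      simp only [Pi.zero_apply]; positivity
  have htop : ∀ T : ℝ, 0 < T →
      ‖∫ x : ℝ in (-1)..1, poissonIntegrand j μ L (x + T * I)‖ ≤
        2 * ((2 + T) ^ (1 + 2 * μ) * Real.exp (-(L * T))) := by
    intro T hT
    have := intervalIntegral.norm_integral_le_of_norm_le_const (a := (-1 : ℝ)) (b := 1)
      (f := fun x : ℝ => poissonIntegrand j μ L (x + T * I))
      (C := (2 + T) ^ (1 + 2 * μ) * Real.exp (-(L * T))) ?_
    · refine this.trans_eq ?_
      norm_num; ring
    · intro x hx
      rw [Set.uIoc_of_le (by norm_num)] at hx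
      have hx1 : |x| ≤ 1 := abs_le.2 ⟨hx.1.le, hx.2⟩
      have h1 : ‖(x : ℂ) + T * I‖ ≤ 1 + T := by
        refine (norm_add_le _ _).trans ?_
        simp [abs_of_nonneg hT.le, hx1]
      have h1' : ‖(x : ℂ) + T * I‖ ^ j ≤ 2 + T := by
        interval_cases j
        · simp; linarith
        · simp only [pow_one]; linarith
      have h2 : ‖1 - ((x : ℂ) + T * I) ^ 2‖ ≤ (2 + T) ^ 2 := by
        refine (norm_sub_le _ _).trans ?_
        rw [norm_pow, norm_one]
        nlinarith [norm_nonneg ((x : ℂ) + T * I)]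
      have h3 : ‖1 - ((x : ℂ) + T * I) ^ 2‖ ^ μ ≤ (2 + T) ^ (2 * μ) := by
        refine (Real.rpow_le_rpow (norm_nonneg _) h2 hμ.le).trans_eq ?_
        rw [Real.rpow_mul (by positivity), Real.rpow_two]
      rw [norm_poissonIntegrand]
      have him : ((x : ℂ) + T * I).im = T := by simp
      rw [him, Real.rpow_add (by positivity), Real.rpow_one]
      calc _ ≤ (2 + T) * Real.exp (-(L * T)) * (2 + T) ^ (2 * μ) := by gcongr
        _ = _ := by ring
  have hlim : Tendsto (fun T : ℝ => 2 * ((2 + T) ^ (1 + 2 * μ) * Real.exp (-(L * T)))) atTop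
      (𝓝 0) := by
    have h1 := tendsto_rpow_mul_exp_neg_mul_atTop_nhds_zero (1 + 2 * μ) L hL0
    have h2 := h1.comp (tendsto_atTop_add_const_left atTop (2 : ℝ) tendsto_id)
    have h3 := h2.const_mul (2 * Real.exp (2 * L))
    rw [mul_zero] at h3
    refine h3.congr fun T => ?_
    simp only [Function.comp, id]
    rw [show -L * (2 + T) = -(2 * L) + -(L * T) by ring, Real.exp_add, Real.exp_neg (2 * L)]
    field_simp
  have hle : ∀ T : ℝ, 0 < T → ‖∫ x : ℝ in (-1)..1, poissonIntegrand j μ L x‖ ≤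
      2 * ((2 + T) ^ (1 + 2 * μ) * Real.exp (-(L * T))) + 2 * B := by
    intro T hT
    rw [poissonIntegrand_rect hμ (T := T)]
    refine (norm_add_le _ _).trans ?_
    have h1 := hside 1 (by norm_num) T hT
    have h2 := hside (-1) (by norm_num) T hT
    have h3 := htop T hT
    push_cast at h1 h2
    have h4 := norm_sub_le (∫ x : ℝ in (-1)..1, poissonIntegrand j μ L (x + T * I))
      (I * ∫ y : ℝ in 0..T, poissonIntegrand j μ L (1 + y * I))
    simp only [norm_mul, norm_I, one_mul] at h4 ⊢
    linarith
  have := le_of_tendsto_of_tendsto tendsto_const_nhds (hlim.add_const (2 * B))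
    ((eventually_gt_atTop 0).mono hle)
  rw [zero_add] at this
  refine this.trans_eq ?_
  rw [hB]; ring

end

/-! ### Decay of the Fourier transform of the surface measure -/

section

/-- Splitting off the coordinate along a unit vector is measure preserving. -/
lemma exists_measurePreserving_inner {m : ℕ} {e : EuclideanSpace ℝ (Fin (m + 1))} (he : ‖e‖ = 1) :
    ∃ Ψ : EuclideanSpace ℝ (Fin (m + 1)) → ℝ × EuclideanSpace ℝ (Fin m),
      MeasurePreserving Ψ ∧ ∀ y, (Ψ y).1 = inner ℝ e y ∧
        (Ψ y).1 ^ 2 + ‖(Ψ y).2‖ ^ 2 = ‖y‖ ^ 2 := by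
  obtain ⟨b, hb⟩ := Orthonormal.exists_orthonormalBasis_extension_of_card_eq (𝕜 := ℝ)
    (E := EuclideanSpace ℝ (Fin (m + 1))) (ι := Fin (m + 1)) (by simp) (v := fun _ => e) (s := {0})
    (by
      rw [orthonormal_iff_ite]
      rintro ⟨i, hi⟩ ⟨j, hj⟩
      simp only [Set.mem_singleton_iff] at hi hj
      subst hi; subst hj
      simp [he])
  have hb0 : b 0 = e := hb 0 rfl
  have h1 := b.repr.measurePreserving
  have h2 := PiLp.volume_preserving_ofLp (Fin (m + 1))
  have h3 := volume_preserving_piFinSuccAbove (fun _ : Fin (m + 1) => ℝ) 0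
  have h4 := (MeasurePreserving.id (volume : Measure ℝ)).prod (PiLp.volume_preserving_toLp (Fin m))
  refine ⟨_, h4.comp (h3.comp (h2.comp h1)), fun y => ⟨?_, ?_⟩⟩
  · simp [MeasurableEquiv.piFinSuccAbove, b.repr_apply_apply, hb0]
  · rw [← b.repr.norm_map y, EuclideanSpace.real_norm_sq_eq, EuclideanSpace.real_norm_sq_eq,
      Fin.sum_univ_succ]
    simp [MeasurableEquiv.piFinSuccAbove, Fin.tail]

/-- Slicing the unit ball by hyperplanes orthogonal to `e`. -/
lemma integral_ball_inner {m : ℕ} (hm : 1 ≤ m) {e : EuclideanSpace ℝ (Fin (m + 1))}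
    (he : ‖e‖ = 1) {φ : ℝ → ℂ} (hφ : Continuous φ) :
    ∫ y in Metric.ball (0 : EuclideanSpace ℝ (Fin (m + 1))) 1, φ (inner ℝ e y) =
      ((volume.real (Metric.ball (0 : EuclideanSpace ℝ (Fin m)) 1) : ℝ) : ℂ) *
        ∫ t : ℝ in (-1)..1, φ t * (((1 - t ^ 2) ^ ((m : ℝ) / 2) : ℝ) : ℂ) := by
  have : Nontrivial (EuclideanSpace ℝ (Fin m)) :=
    Module.nontrivial_of_finrank_pos (R := ℝ) (by rw [finrank_euclideanSpace_fin]; omega)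
  obtain ⟨Ψ, hΨ, hΨ'⟩ := exists_measurePreserving_inner he
  set A : Set (ℝ × EuclideanSpace ℝ (Fin m)) := {p | p.1 ^ 2 + ‖p.2‖ ^ 2 < 1} with hA
  have hAm : MeasurableSet A := measurableSet_lt (by fun_prop) measurable_const
  set G : ℝ × EuclideanSpace ℝ (Fin m) → ℂ := A.indicator (fun p => φ p.1) with hG
  have hGm : Measurable G := (hφ.measurable.comp measurable_fst).indicator hAm
  have hball : Ψ ⁻¹' A = Metric.ball (0 : EuclideanSpace ℝ (Fin (m + 1))) 1 := by
    ext y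
    rw [Set.mem_preimage, hA, Set.mem_ofPred_eq, (hΨ' y).2, mem_ball_zero_iff, sq_lt_one_iff₀
      (norm_nonneg _)]
  have hcomp : G ∘ Ψ = (Metric.ball (0 : EuclideanSpace ℝ (Fin (m + 1))) 1).indicator
      (fun y => φ (inner ℝ e y)) := by
    funext y
    rw [← hball]
    simp only [Function.comp, hG, Set.indicator, Set.mem_preimage, (hΨ' y).1]
  have hint : Integrable (G ∘ Ψ) := by
    rw [hcomp, integrable_indicator_iff Metric.isOpen_ball.measurableSet]
    exact ((by fun_prop : Continuous fun y : EuclideanSpace ℝ (Fin (m + 1)) =>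
      φ (inner ℝ e y)).continuousOn.integrableOn_compact
      (isCompact_closedBall 0 1)).mono_set Metric.ball_subset_closedBall
  have hGint : Integrable G := (hΨ.integrable_comp hGm.aestronglyMeasurable).1 hint
  rw [← integral_indicator Metric.isOpen_ball.measurableSet, ← hcomp]
  have h1 : ∫ y, (G ∘ Ψ) y = ∫ p, G p := by
    rw [← hΨ.map_eq, integral_map hΨ.measurable.aemeasurable hGm.aestronglyMeasurable]; rfl
  rw [h1]
  have h2 : ∫ p, G p = ∫ t, ∫ z, G (t, z) := integral_prod G hGint
  have h3 : ∀ t : ℝ, ∫ z, G (t, z) = (Set.Ioc (-1 : ℝ) 1).indicator (fun t =>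
      ((volume.real (Metric.ball (0 : EuclideanSpace ℝ (Fin m)) 1) : ℝ) : ℂ) *
        (φ t * (((1 - t ^ 2) ^ ((m : ℝ) / 2) : ℝ) : ℂ))) t := by
    intro t
    by_cases ht : t ∈ Set.Ioc (-1 : ℝ) 1
    · have ht2 : 0 ≤ 1 - t ^ 2 := by nlinarith [ht.1, ht.2]
      have h4 : ∀ z, G (t, z) =
          (Metric.ball (0 : EuclideanSpace ℝ (Fin m)) √(1 - t ^ 2)).indicator (fun _ => φ t) z := by
        intro z
        have : (t, z) ∈ A ↔ z ∈ Metric.ball (0 : EuclideanSpace ℝ (Fin m)) √(1 - t ^ 2) := by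
          rw [hA, Set.mem_ofPred_eq, mem_ball_zero_iff, Real.lt_sqrt (norm_nonneg z)]
          constructor <;> intro h <;> linarith
        by_cases hz : (t, z) ∈ A
        · rw [hG, Set.indicator_of_mem hz, Set.indicator_of_mem (this.1 hz)]
        · rw [hG, Set.indicator_of_notMem hz, Set.indicator_of_notMem (this.not.1 hz)]
      simp_rw [h4]
      rw [integral_indicator Metric.isOpen_ball.measurableSet, setIntegral_const,
        Set.indicator_of_mem ht, Measure.real, Measure.addHaar_ball _ _ (Real.sqrt_nonneg _),
        finrank_euclideanSpace_fin, ENNReal.toReal_mul, ENNReal.toReal_ofReal (by positivity),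
        Complex.real_smul]
      have h5 : √(1 - t ^ 2) ^ m = (1 - t ^ 2) ^ ((m : ℝ) / 2) := by
        rw [Real.sqrt_eq_rpow, ← Real.rpow_natCast, ← Real.rpow_mul ht2]
        congr 1; ring
      rw [h5, Measure.real]
      push_cast; ring
    · rw [Set.indicator_of_notMem ht]
      have ht2 : 1 ≤ t ^ 2 := by
        by_contra hlt
        rw [not_le, sq_lt_one_iff_abs_lt_one, abs_lt] at hlt
        exact ht ⟨hlt.1, hlt.2.le⟩
      have h4 : ∀ z, G (t, z) = 0 := by
        intro z
        refine Set.indicator_of_notMem ?_ _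
        rw [hA, Set.mem_ofPred_eq]
        nlinarith [sq_nonneg ‖z‖]
      simp [h4]
  rw [h2]
  simp_rw [h3]
  rw [integral_indicator measurableSet_Ioc, integral_const_mul,
    intervalIntegral.integral_of_le (by norm_num)]

lemma integral_ball_planeWave_eq {m : ℕ} (hm : 1 ≤ m) {e : EuclideanSpace ℝ (Fin (m + 1))}
    (he : ‖e‖ = 1) (L : ℝ) {r : ℝ} (hr : 0 < r) :
    ∫ y in Metric.ball (0 : EuclideanSpace ℝ (Fin (m + 1))) r, planeWave (-L • e) y =
      ((volume.real (Metric.ball (0 : EuclideanSpace ℝ (Fin m)) 1) : ℝ) : ℂ) * ((r : ℂ) ^ (m + 1) *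
        ∫ t : ℝ in (-1)..1, poissonIntegrand 0 ((m : ℝ) / 2) (r * L) t) := by
  have h1 := integral_ball_inner hm he (φ := fun t => Complex.exp (Complex.I * (r * L : ℝ) * t))
    (by fun_prop)
  have h2 := Measure.setIntegral_comp_smul_of_pos
    (volume : Measure (EuclideanSpace ℝ (Fin (m + 1))))
    (fun y => planeWave (-L • e) y) (Metric.ball 0 1) hr
  rw [smul_unitBall_of_pos hr, finrank_euclideanSpace_fin] at h2
  have h3 : ∀ y, planeWave (-L • e) (r • y) =
      Complex.exp (Complex.I * (r * L : ℝ) * ((inner ℝ e y : ℝ) : ℂ)) := by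
    intro y
    rw [planeWave, inner_smul_left, inner_smul_right]
    congr 1
    simp; ring
  simp_rw [h3] at h2
  rw [h1] at h2
  have hr' : (r : ℂ) ≠ 0 := by exact_mod_cast hr.ne'
  have h4 : ∫ t : ℝ in (-1)..1, Complex.exp (Complex.I * (r * L : ℝ) * t) *
        (((1 - t ^ 2) ^ ((m : ℝ) / 2) : ℝ) : ℂ) =
      ∫ t : ℝ in (-1)..1, poissonIntegrand 0 ((m : ℝ) / 2) (r * L) t := by
    refine intervalIntegral.integral_congr fun t ht => ?_
    rw [Set.uIcc_of_le (by norm_num)] at ht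
    simp only [poissonIntegrand, pow_zero, one_mul]
    rw [Complex.ofReal_cpow (by nlinarith [ht.1, ht.2])]
    push_cast; rfl
  rw [h4, Complex.real_smul] at h2
  rw [mul_left_comm, h2]
  push_cast
  field_simp

/-- Integration in polar coordinates writes the transform of a ball as a primitive. -/
lemma integral_ball_planeWave_eq_primitive {n : ℕ} (hn : 1 ≤ n) (x : EuclideanSpace ℝ (Fin n))
    {r : ℝ} (hr : 0 < r) :
    ∫ y in Metric.ball (0 : EuclideanSpace ℝ (Fin n)) r, planeWave x y =
      ∫ s in (0 : ℝ)..r, ((s ^ (n - 1) : ℝ) : ℂ) * fourierSphere (fun _ => 1) (s • x) := by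
  have hint : Integrable ((Metric.ball (0 : EuclideanSpace ℝ (Fin n)) r).indicator
      (fun y => planeWave x y)) := by
    rw [integrable_indicator_iff Metric.isOpen_ball.measurableSet]
    exact ((by fun_prop : Continuous fun y => planeWave x y).continuousOn.integrableOn_compact
      (isCompact_closedBall 0 r)).mono_set Metric.ball_subset_closedBall
  rw [← integral_indicator Metric.isOpen_ball.measurableSet, integral_eq_integral_sphere hn hint,
    intervalIntegral.integral_of_le hr.le, integral_Ioc_eq_integral_Ioo,
    ← integral_indicator measurableSet_Ioi, ← integral_indicator measurableSet_Ioo]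
  refine integral_congr_ae (Filter.Eventually.of_forall fun s => ?_)
  by_cases hs : 0 < s
  · by_cases hsr : s < r
    · rw [Set.indicator_of_mem (show s ∈ Set.Ioi 0 from hs),
        Set.indicator_of_mem (show s ∈ Set.Ioo 0 r from ⟨hs, hsr⟩), fourierSphere_one_eq]
      congr 1
      refine integral_congr_ae (Filter.Eventually.of_forall fun ω => ?_)
      simp only
      rw [Set.indicator_of_mem (by simp [norm_smul, abs_of_pos hs, hsr])]
      simp only [planeWave, inner_smul_left, inner_smul_right]
      simp
    · rw [Set.indicator_of_mem (show s ∈ Set.Ioi 0 from hs),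
        Set.indicator_of_notMem (fun h : s ∈ Set.Ioo 0 r => hsr h.2)]
      have : ∀ ω : Metric.sphere (0 : EuclideanSpace ℝ (Fin n)) 1,
          (Metric.ball (0 : EuclideanSpace ℝ (Fin n)) r).indicator (fun y => planeWave x y)
            (s • (ω : EuclideanSpace ℝ (Fin n))) = 0 := by
        intro ω
        refine Set.indicator_of_notMem ?_ _
        simp [norm_smul, abs_of_pos hs, not_lt.1 hsr]
      simp [this]
  · rw [Set.indicator_of_notMem (show s ∉ Set.Ioi 0 from hs),
      Set.indicator_of_notMem (fun h : s ∈ Set.Ioo 0 r => hs h.1)]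

lemma hasDerivAt_integral_poissonIntegrand {μ : ℝ} (hμ : 0 < μ) (L : ℝ) :
    HasDerivAt (fun L : ℝ => ∫ t : ℝ in (-1)..1, poissonIntegrand 0 μ L t)
      (Complex.I * ∫ t : ℝ in (-1)..1, poissonIntegrand 1 μ L t) L := by
  have hmeas : ∀ (j : ℕ) (L : ℝ), Measurable fun t : ℝ => poissonIntegrand j μ L t := by
    intro j L
    unfold poissonIntegrand
    fun_prop
  have hbound : ∀ (j : ℕ) (L : ℝ), ∀ t ∈ Set.uIoc (-1 : ℝ) 1, ‖poissonIntegrand j μ L t‖ ≤ 1 := by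
    intro j L t ht
    rw [Set.uIoc_of_le (by norm_num)] at ht
    have h1 : |t| ≤ 1 := abs_le.2 ⟨ht.1.le, ht.2⟩
    have h2 : 0 ≤ 1 - t ^ 2 := by nlinarith [ht.1, ht.2]
    have h3 : ‖1 - (t : ℂ) ^ 2‖ = 1 - t ^ 2 := by
      have : 1 - (t : ℂ) ^ 2 = ((1 - t ^ 2 : ℝ) : ℂ) := by push_cast; rfl
      rw [this, Complex.norm_real, Real.norm_eq_abs, abs_of_nonneg h2]
    rw [norm_poissonIntegrand, h3, Complex.norm_real, Real.norm_eq_abs]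
    simp only [Complex.ofReal_im, mul_zero, neg_zero, Real.exp_zero, mul_one]
    exact mul_le_one₀ (pow_le_one₀ (abs_nonneg _) h1) (by positivity)
      (Real.rpow_le_one h2 (by nlinarith [sq_nonneg t]) hμ.le)
  have h := (intervalIntegral.hasDerivAt_integral_of_dominated_loc_of_deriv_le (μ := volume)
    (a := (-1 : ℝ)) (b := 1) (F := fun (L : ℝ) (t : ℝ) => poissonIntegrand 0 μ L t)
    (F' := fun (L : ℝ) (t : ℝ) => Complex.I * poissonIntegrand 1 μ L t) (x₀ := L)
    (s := Set.univ) (bound := fun _ => 1)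
    Filter.univ_mem (Filter.Eventually.of_forall fun L => (hmeas 0 L).aestronglyMeasurable) ?_
    ((hmeas 1 L).const_mul _).aestronglyMeasurable ?_ intervalIntegrable_const ?_).2
  · rwa [intervalIntegral.integral_const_mul] at h
  · refine IntervalIntegrable.mono_fun' (g := fun _ => (1 : ℝ)) intervalIntegrable_const
      (hmeas 0 L).aestronglyMeasurable ?_
    exact (ae_restrict_iff' measurableSet_uIoc).2 (Filter.Eventually.of_forall (hbound 0 L))
  · refine Filter.Eventually.of_forall fun t ht L _ => ?_
    rw [norm_mul, Complex.norm_I, one_mul]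
    exact hbound 1 L t ht
  · refine Filter.Eventually.of_forall fun t ht L _ => ?_
    have h1 : HasDerivAt (fun L : ℝ => Complex.exp (Complex.I * L * t))
        (Complex.exp (Complex.I * L * t) * (Complex.I * t)) L := by
      have : HasDerivAt (fun L : ℝ => Complex.I * (L : ℂ) * t) (Complex.I * t) L := by
        simpa using ((Complex.ofRealCLM.hasDerivAt (x := L)).const_mul Complex.I).mul_const (t : ℂ)
      exact this.cexp
    have h2 := h1.mul_const ((1 - (t : ℂ) ^ 2) ^ (μ : ℂ))
    refine (h2.congr_deriv ?_).congr_of_eventuallyEq (Filter.Eventually.of_forall fun L => ?_)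
    · simp only [poissonIntegrand]; ring
    · simp only [poissonIntegrand]; ring

/-- The Fourier transform of the unit sphere of `ℝ^{m+1}` in terms of one-dimensional integrals:
both sides are the derivative at `r = 1` of the transform of the ball of radius `r`. -/
lemma fourierSphere_one_smul {m : ℕ} (hm : 1 ≤ m) {e : EuclideanSpace ℝ (Fin (m + 1))}
    (he : ‖e‖ = 1) (L : ℝ) :
    fourierSphere (fun _ => 1) (-L • e) =
      ((volume.real (Metric.ball (0 : EuclideanSpace ℝ (Fin m)) 1) : ℝ) : ℂ) *
        ((m + 1 : ℕ) * (∫ t : ℝ in (-1)..1, poissonIntegrand 0 ((m : ℝ) / 2) L t) +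
          L * (Complex.I * ∫ t : ℝ in (-1)..1, poissonIntegrand 1 ((m : ℝ) / 2) L t)) := by
  have hμ : 0 < (m : ℝ) / 2 := by positivity
  have hcont : Continuous (fourierSphere (n := m + 1) fun _ => 1) :=
    continuous_fourierSphere (integrable_const _)
  have h1 : HasDerivAt (fun r : ℝ => ∫ s in (0 : ℝ)..r, ((s ^ (m + 1 - 1) : ℝ) : ℂ) *
      fourierSphere (fun _ => 1) (s • (-L • e))) (fourierSphere (fun _ => 1) (-L • e)) 1 := by
    have hc : Continuous fun s : ℝ => ((s ^ (m + 1 - 1) : ℝ) : ℂ) *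
        fourierSphere (fun _ => 1) (s • (-L • e)) := by fun_prop
    have := intervalIntegral.integral_hasDerivAt_right (hc.intervalIntegrable 0 1)
      (hc.stronglyMeasurableAtFilter _ _) hc.continuousAt
    simpa using this
  have h2 : HasDerivAt (fun r : ℝ =>
      ((volume.real (Metric.ball (0 : EuclideanSpace ℝ (Fin m)) 1) : ℝ) : ℂ) * ((r : ℂ) ^ (m + 1) *
        ∫ t : ℝ in (-1)..1, poissonIntegrand 0 ((m : ℝ) / 2) (r * L) t))
      (((volume.real (Metric.ball (0 : EuclideanSpace ℝ (Fin m)) 1) : ℝ) : ℂ) *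
        ((m + 1 : ℕ) * (∫ t : ℝ in (-1)..1, poissonIntegrand 0 ((m : ℝ) / 2) L t) +
          L * (Complex.I * ∫ t : ℝ in (-1)..1, poissonIntegrand 1 ((m : ℝ) / 2) L t))) 1 := by
    have ha : HasDerivAt (fun r : ℝ => (r : ℂ) ^ (m + 1)) ((m + 1 : ℕ) : ℂ) 1 := by
      have := (Complex.ofRealCLM.hasDerivAt (x := (1 : ℝ))).pow (m + 1)
      exact (this.congr_deriv (by simp)).congr_of_eventuallyEq
        (Filter.Eventually.of_forall fun r => by simp)
    have hb : HasDerivAt (fun r : ℝ => r * L) L 1 := by simpa using hasDerivAt_mul_const L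
    have hc := hasDerivAt_integral_poissonIntegrand hμ (1 * L)
    have hd := hc.scomp (1 : ℝ) hb
    rw [one_mul] at hd
    have := (ha.mul hd).const_mul
      ((volume.real (Metric.ball (0 : EuclideanSpace ℝ (Fin m)) 1) : ℝ) : ℂ)
    refine this.congr_deriv ?_
    simp [Complex.real_smul]
  refine h1.unique (h2.congr_of_eventuallyEq ?_)
  filter_upwards [lt_mem_nhds (zero_lt_one' ℝ)] with r hr
  rw [← integral_ball_planeWave_eq_primitive (by omega) _ hr, integral_ball_planeWave_eq hm he L hr]

/-- The stationary phase bound `|σ̂(x)| ≤ C max(1, |x|)^{-(n-1)/2}`. -/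
theorem exists_norm_fourierSphere_one_le {n : ℕ} (hn : 2 ≤ n) : ∃ C : ℝ, 0 < C ∧
    ∀ x : EuclideanSpace ℝ (Fin n), ‖fourierSphere (fun _ => 1) x‖ ≤
      C * (max 1 ‖x‖) ^ (-(((n : ℝ) - 1) / 2)) := by
  obtain ⟨m, rfl⟩ : ∃ m, n = m + 1 := ⟨n - 1, by omega⟩
  have hm : 1 ≤ m := by omega
  have hμ : 0 < (m : ℝ) / 2 := by positivity
  obtain ⟨C, hC0, hC⟩ := exists_norm_integral_poissonIntegrand_le hμ
  set v : ℝ := volume.real (Metric.ball (0 : EuclideanSpace ℝ (Fin m)) 1) with hv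
  have hv0 : 0 ≤ v := measureReal_nonneg
  set M : ℝ := (surfaceMeasure (m + 1)).real Set.univ with hM
  have hM0 : 0 ≤ M := measureReal_nonneg
  have hq : (((m + 1 : ℕ) : ℝ) - 1) / 2 = (m : ℝ) / 2 := by push_cast; ring
  refine ⟨M + v * ((m + 2) * C) + 1, by positivity, fun x => ?_⟩
  rw [hq]
  rcases le_total ‖x‖ 1 with hx | hx
  · rw [max_eq_left hx, Real.one_rpow, mul_one]
    refine (norm_fourierSphere_one_le x).trans ?_
    have : 0 ≤ v * ((m + 2) * C) := by positivity
    linarith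
  · rw [max_eq_right hx]
    have hx0 : 0 < ‖x‖ := by linarith
    set e : EuclideanSpace ℝ (Fin (m + 1)) := -(‖x‖⁻¹ • x) with he
    have he1 : ‖e‖ = 1 := by
      rw [he, norm_neg, norm_smul, norm_inv, norm_norm, inv_mul_cancel₀ hx0.ne']
    have hxe : x = -‖x‖ • e := by
      rw [he, smul_neg, neg_smul, neg_neg, smul_smul, mul_inv_cancel₀ hx0.ne', one_smul]
    have h0 := hC 0 (by norm_num) ‖x‖ hx
    have h1 := hC 1 le_rfl ‖x‖ hx
    have h2 : ‖x‖ ^ (-((m : ℝ) / 2 + 1)) ≤ ‖x‖ ^ (-((m : ℝ) / 2)) :=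
      Real.rpow_le_rpow_of_exponent_le hx (by linarith)
    have h3 : ‖x‖ * ‖x‖ ^ (-((m : ℝ) / 2 + 1)) = ‖x‖ ^ (-((m : ℝ) / 2)) := by
      rw [← Real.rpow_one_add' hx0.le (by linarith)]
      congr 1; ring
    have h4 : 0 ≤ ‖x‖ ^ (-((m : ℝ) / 2)) := by positivity
    have h5 : ‖fourierSphere (fun _ => 1) x‖ ≤
        v * ((m + 2) * C) * ‖x‖ ^ (-((m : ℝ) / 2)) := by
      rw [hxe, fourierSphere_one_smul hm he1, ← hxe]
      rw [norm_mul, Complex.norm_real, Real.norm_eq_abs, abs_of_nonneg hv0, mul_assoc]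
      refine mul_le_mul_of_nonneg_left ((norm_add_le _ _).trans ?_) hv0
      rw [norm_mul, norm_mul, norm_mul, Complex.norm_I, one_mul, Complex.norm_real, norm_norm,
        Complex.norm_natCast]
      calc _ ≤ ((m + 1 : ℕ) : ℝ) * (C * ‖x‖ ^ (-((m : ℝ) / 2 + 1))) +
            ‖x‖ * (C * ‖x‖ ^ (-((m : ℝ) / 2 + 1))) := by gcongr
        _ = ((m : ℝ) + 1) * C * ‖x‖ ^ (-((m : ℝ) / 2 + 1)) + C * ‖x‖ ^ (-((m : ℝ) / 2)) := by
            rw [← h3]; push_cast; ring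
        _ ≤ ((m : ℝ) + 1) * C * ‖x‖ ^ (-((m : ℝ) / 2)) + C * ‖x‖ ^ (-((m : ℝ) / 2)) := by
            gcongr
        _ = _ := by ring
    refine h5.trans ?_
    gcongr
    linarith

end

/-! ### The Kerman–Sawyer norm controls the mass of balls -/

section
variable {n : ℕ}

lemma norm_sub_le_of_mem_dyadicCube {k : ℤ} {m : Fin n → ℤ} {x y : EuclideanSpace ℝ (Fin n)}
    (hx : x ∈ dyadicCube k m) (hy : y ∈ dyadicCube k m) : ‖x - y‖ ≤ n * (2 : ℝ) ^ k := by
  have h2 : (0 : ℝ) < (2 : ℝ) ^ k := by positivity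
  refine abs_le_of_sq_le_sq' ?_ (by positivity) |>.2
  rw [EuclideanSpace.real_norm_sq_eq]
  calc ∑ i, (x - y) i ^ 2 ≤ ∑ _i : Fin n, ((2 : ℝ) ^ k) ^ 2 := by
        refine Finset.sum_le_sum fun i _ => ?_
        have h1 := hx i
        have h3 := hy i
        rw [add_mul, one_mul] at h1 h3
        rw [PiLp.sub_apply]
        exact sq_le_sq' (by linarith) (by linarith)
    _ = n * ((2 : ℝ) ^ k) ^ 2 := by simp
    _ ≤ (n * (2 : ℝ) ^ k) ^ 2 := by
        rw [mul_pow]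
        gcongr
        have : (n : ℝ) ≤ (n : ℝ) ^ 2 := by exact_mod_cast Nat.le_self_pow two_ne_zero n
        exact this

lemma measurableSet_dyadicCube (k : ℤ) (m : Fin n → ℤ) : MeasurableSet (dyadicCube k m) := by
  unfold dyadicCube
  rw [Set.ofPred_forall]
  refine MeasurableSet.iInter fun i => ?_
  have hi : Measurable fun x : EuclideanSpace ℝ (Fin n) => x i := by fun_prop
  exact (measurableSet_le measurable_const hi).inter (measurableSet_lt hi measurable_const)

lemma setLIntegral_dyadicCube_lt_top {v : EuclideanSpace ℝ (Fin n) → ℝ}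
    (hv : LocallyIntegrable v) (k : ℤ) (m : Fin n → ℤ) :
    ∫⁻ x in dyadicCube k m, ENNReal.ofReal (v x) < ∞ := by
  rcases (dyadicCube k m).eq_empty_or_nonempty with h | ⟨x₀, hx₀⟩
  · simp [h]
  have hsub : dyadicCube k m ⊆ Metric.closedBall x₀ (n * (2 : ℝ) ^ k) := fun x hx => by
    rw [mem_closedBall_iff_norm]; exact norm_sub_le_of_mem_dyadicCube hx hx₀
  have hint : IntegrableOn v (dyadicCube k m) :=
    (hv.integrableOn_isCompact (isCompact_closedBall x₀ _)).mono_set hsub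
  refine lt_of_le_of_lt (lintegral_mono fun x => ?_) hint.2
  rw [← ofReal_norm]
  exact ENNReal.ofReal_le_ofReal (le_abs_self _)

/-- On a cube the kernel `|x - y|^{α - n}` is bounded below by a power of the diameter, so a single
cube in the supremum already bounds the mass of that cube. -/
lemma setLIntegral_dyadicCube_le (hn : 0 < n) {α : ℝ} (hα : α < n)
    {v : EuclideanSpace ℝ (Fin n) → ℝ}
    (hv0 : ∀ x, 0 ≤ v x) (hv : LocallyIntegrable v) (k : ℤ) (m : Fin n → ℤ) :
    ∫⁻ x in dyadicCube k m, ENNReal.ofReal (v x) ≤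
      kermanSawyerNorm α v * ENNReal.ofReal ((n * (2 : ℝ) ^ k) ^ ((n : ℝ) - α)) := by
  set Q := dyadicCube k m with hQ
  set I := ∫⁻ x in Q, ENNReal.ofReal (v x) with hI
  set D : ℝ := (n * (2 : ℝ) ^ k) ^ ((n : ℝ) - α) with hD
  have hItop : I ≠ ∞ := (setLIntegral_dyadicCube_lt_top hv k m).ne
  rcases eq_or_ne I 0 with hI0 | hI0
  · rw [hI0]; exact zero_le
  have hD0 : 0 < D := by positivity
  have hdouble : I * (I * (ENNReal.ofReal D)⁻¹) ≤ ∫⁻ x in Q, ∫⁻ y in Q,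
      ENNReal.ofReal (v x * v y / ‖x - y‖ ^ ((n : ℝ) - α)) := by
    have hDinv : (ENNReal.ofReal D)⁻¹ ≠ ∞ := by simp [hD0]
    rw [hI, ← lintegral_mul_const' _ _ (ENNReal.mul_ne_top hItop hDinv)]
    refine setLIntegral_mono' (measurableSet_dyadicCube k m) fun x hx => ?_
    rw [mul_comm _ (ENNReal.ofReal D)⁻¹, ← mul_assoc, ← lintegral_const_mul' _ _
      (ENNReal.mul_ne_top ENNReal.ofReal_ne_top hDinv)]
    refine lintegral_mono_ae ?_
    have : Nontrivial (EuclideanSpace ℝ (Fin n)) :=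
      Module.nontrivial_of_finrank_pos (R := ℝ) (by rw [finrank_euclideanSpace_fin]; omega)
    have hne : ∀ᵐ y ∂(volume.restrict Q), y ≠ x := by
      refine ae_restrict_of_ae ?_
      simp [ae_iff]
    filter_upwards [hne, ae_restrict_mem (measurableSet_dyadicCube k m)] with y hy hyQ
    rw [← ENNReal.ofReal_inv_of_pos hD0, ← ENNReal.ofReal_mul (hv0 x),
      ← ENNReal.ofReal_mul (mul_nonneg (hv0 x) (by positivity))]
    apply ENNReal.ofReal_le_ofReal
    have h1 : 0 < ‖x - y‖ := norm_pos_iff.2 (sub_ne_zero.2 hy.symm)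
    rw [div_eq_mul_inv, mul_right_comm]
    refine mul_le_mul_of_nonneg_left ?_ (mul_nonneg (hv0 x) (hv0 y))
    apply inv_anti₀ (by positivity)
    exact Real.rpow_le_rpow h1.le (norm_sub_le_of_mem_dyadicCube hx hyQ) (by linarith)
  have h1 : I⁻¹ * (I * (I * (ENNReal.ofReal D)⁻¹)) ≤ kermanSawyerNorm α v := by
    refine (mul_le_mul_right hdouble _).trans ?_
    exact le_iSup₂ (f := fun (k : ℤ) (m : Fin n → ℤ) =>
      (∫⁻ x in dyadicCube k m, ENNReal.ofReal (v x))⁻¹ *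
      ∫⁻ x in dyadicCube k m, ∫⁻ y in dyadicCube k m,
        ENNReal.ofReal (v x * v y / ‖x - y‖ ^ ((n : ℝ) - α))) k m
  rw [← mul_assoc, ENNReal.inv_mul_cancel hI0 hItop, one_mul, ← div_eq_mul_inv] at h1
  exact (ENNReal.div_le_iff_le_mul (Or.inl (by simpa using hD0))
    (Or.inl ENNReal.ofReal_ne_top)).1 h1

/-- A ball of radius `r` is covered by `3ⁿ` dyadic cubes of side comparable with `r`. -/
theorem exists_setLIntegral_ball_le (hn : 0 < n) {α : ℝ} (hα : α < n) : ∃ C : ℝ, 0 < C ∧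
    ∀ v : EuclideanSpace ℝ (Fin n) → ℝ, (∀ x, 0 ≤ v x) → LocallyIntegrable v →
      ∀ (x : EuclideanSpace ℝ (Fin n)) (r : ℝ), 0 < r →
        ∫⁻ y in Metric.ball x r, ENNReal.ofReal (v y) ≤
          kermanSawyerNorm α v * ENNReal.ofReal (C * r ^ ((n : ℝ) - α)) := by
  refine ⟨3 ^ n * (2 * n + 1) ^ ((n : ℝ) - α), by positivity, fun v hv0 hv x r hr => ?_⟩
  obtain ⟨k, hk1, hk2⟩ := exists_mem_Ioc_zpow hr one_lt_two
  set l : ℝ := (2 : ℝ) ^ (k + 1) with hl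
  have hl0 : 0 < l := by positivity
  have hl2 : l ≤ 2 * r := by
    rw [hl, zpow_add_one₀ two_ne_zero]; linarith
  set F : Finset (Fin n → ℤ) :=
    Fintype.piFinset fun i => Finset.Icc (⌊x i / l⌋ - 1) (⌊x i / l⌋ + 1) with hF
  have hcard : F.card = 3 ^ n := by
    rw [hF, Fintype.card_piFinset]
    have : ∀ a : ℤ, (a + 1 + 1 - (a - 1)).toNat = 3 := fun a => by
      rw [show a + 1 + 1 - (a - 1) = 3 by ring]; rfl
    simp [this]
  have hcover : Metric.ball x r ⊆ ⋃ m ∈ F, dyadicCube (k + 1) m := by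
    intro y hy
    rw [mem_ball_iff_norm] at hy
    rw [Set.mem_iUnion₂]
    refine ⟨fun i => ⌊y i / l⌋, ?_, fun i => ⟨?_, ?_⟩⟩
    · rw [hF, Fintype.mem_piFinset]
      intro i
      have h1 : |y i - x i| < l := by
        have := PiLp.norm_apply_le (y - x) i
        rw [PiLp.sub_apply, Real.norm_eq_abs] at this
        linarith
      have h2 : |y i / l - x i / l| < 1 := by
        rw [← sub_div, abs_div, abs_of_pos hl0, div_lt_one hl0]; exact h1
      rw [abs_lt] at h2
      rw [Finset.mem_Icc]
      constructor
      · have : ((⌊x i / l⌋ - 1 : ℤ) : ℝ) ≤ y i / l := by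
          have := Int.floor_le (x i / l); push_cast; linarith
        exact Int.le_floor.2 this
      · have : y i / l < ((⌊x i / l⌋ + 1 + 1 : ℤ) : ℝ) := by
          have := Int.lt_floor_add_one (x i / l); push_cast; linarith
        exact Int.lt_add_one_iff.1 (Int.floor_lt.2 this)
    · rw [← le_div_iff₀ hl0]; exact Int.floor_le _
    · rw [← div_lt_iff₀ hl0]; exact Int.lt_floor_add_one _
  calc ∫⁻ y in Metric.ball x r, ENNReal.ofReal (v y)
      ≤ ∫⁻ y in ⋃ m ∈ F, dyadicCube (k + 1) m, ENNReal.ofReal (v y) := lintegral_mono_set hcover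
    _ ≤ ∑ m ∈ F, ∫⁻ y in dyadicCube (k + 1) m, ENNReal.ofReal (v y) := by
        have hms : MeasurableSet (⋃ m ∈ F, dyadicCube (k + 1) m) :=
          F.measurableSet_biUnion fun m _ => measurableSet_dyadicCube _ _
        rw [← withDensity_apply _ hms]
        refine (measure_biUnion_finset_le _ _).trans_eq (Finset.sum_congr rfl fun m _ => ?_)
        rw [withDensity_apply _ (measurableSet_dyadicCube _ _)]
    _ ≤ ∑ _m ∈ F, kermanSawyerNorm α v * ENNReal.ofReal ((n * l) ^ ((n : ℝ) - α)) :=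
        Finset.sum_le_sum fun m _ => setLIntegral_dyadicCube_le hn hα hv0 hv _ _
    _ = kermanSawyerNorm α v * ENNReal.ofReal (3 ^ n * (n * l) ^ ((n : ℝ) - α)) := by
        rw [Finset.sum_const, hcard, nsmul_eq_mul, ENNReal.ofReal_mul (by positivity)]
        push_cast
        rw [ENNReal.ofReal_pow (by norm_num)]
        simp only [ENNReal.ofReal_ofNat]; ring
    _ ≤ _ := by
        refine mul_le_mul_right (ENNReal.ofReal_le_ofReal ?_) _
        rw [mul_assoc, ← Real.mul_rpow (by positivity) hr.le]
        have : (n : ℝ) * l ≤ (2 * n + 1) * r := by nlinarith [(Nat.cast_nonneg n : (0 : ℝ) ≤ n)]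
        gcongr

/-- If `u` has mass at most `r^s` on balls of radius `r` and `s < q`, the potential of `u` with
kernel `max(R, |x|)^{-q}` is at most of order `R^{s - q}`, by summation over dyadic shells. -/
theorem exists_lintegral_kernel_le {s q : ℝ} (hsq : s < q) (hq : 0 ≤ q) : ∃ C : ℝ, 0 < C ∧
    ∀ u : EuclideanSpace ℝ (Fin n) → ℝ≥0∞, Measurable u →
      (∀ (x : EuclideanSpace ℝ (Fin n)) (r : ℝ), 0 < r →
        ∫⁻ y in Metric.ball x r, u y ≤ ENNReal.ofReal (r ^ s)) →
      ∀ (R : ℝ), 0 < R → ∀ x : EuclideanSpace ℝ (Fin n),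
        ∫⁻ y, ENNReal.ofReal ((max R ‖x - y‖) ^ (-q)) * u y ≤ ENNReal.ofReal (C * R ^ (s - q)) := by
  set ρ : ℝ := 2 ^ (s - q) with hρ
  have hρ0 : 0 < ρ := by positivity
  have hρ1 : ρ < 1 := Real.rpow_lt_one_of_one_lt_of_neg one_lt_two (by linarith)
  have h1ρ : 0 < 1 - ρ := by linarith
  refine ⟨2 ^ q * (1 - ρ)⁻¹, by positivity, fun u hu hball R hR x => ?_⟩
  have hpt : ∀ y, ENNReal.ofReal ((max R ‖x - y‖) ^ (-q)) * u y ≤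
      ∑' j : ℕ, ENNReal.ofReal (2 ^ q * (2 ^ j * R) ^ (-q)) *
        (Metric.ball x (2 ^ j * R)).indicator u y := by
    intro y
    have hex : ∃ j : ℕ, ‖x - y‖ < 2 ^ j * R := by
      obtain ⟨j, hj⟩ := pow_unbounded_of_one_lt (‖x - y‖ / R) (one_lt_two : (1 : ℝ) < 2)
      exact ⟨j, (div_lt_iff₀ hR).1 hj⟩
    classical
    set j := Nat.find hex with hj
    have hjs : ‖x - y‖ < 2 ^ j * R := Nat.find_spec hex
    refine le_trans ?_ (ENNReal.le_tsum j)
    rw [Set.indicator_of_mem (by rwa [mem_ball_iff_norm, norm_sub_rev])]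
    gcongr
    have hle : 2 ^ j * R ≤ 2 * max R ‖x - y‖ := by
      rcases Nat.eq_zero_or_pos j with h0 | h0
      · rw [h0, pow_zero, one_mul]; nlinarith [le_max_left R ‖x - y‖]
      · have := Nat.find_min hex (m := j - 1) (by omega)
        rw [not_lt] at this
        have e : (2 : ℝ) ^ j = 2 * 2 ^ (j - 1) := by
          rw [← pow_succ']; congr 1; omega
        rw [e, mul_assoc]
        gcongr
        exact this.trans (le_max_right _ _)
    have hm0 : 0 < max R ‖x - y‖ := lt_max_of_lt_left hR
    calc (max R ‖x - y‖) ^ (-q) = 2 ^ q * (2 * max R ‖x - y‖) ^ (-q) := by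
          rw [Real.mul_rpow (by norm_num) hm0.le, ← mul_assoc, ← Real.rpow_add two_pos]; simp
      _ ≤ 2 ^ q * (2 ^ j * R) ^ (-q) := by
          gcongr 2 ^ q * ?_
          exact Real.rpow_le_rpow_of_nonpos (by positivity) hle (by linarith)
  refine (lintegral_mono hpt).trans ?_
  rw [lintegral_tsum fun j => ((hu.indicator Metric.isOpen_ball.measurableSet).const_mul
    _).aemeasurable]
  have hj : ∀ j : ℕ, ∫⁻ y, ENNReal.ofReal (2 ^ q * (2 ^ j * R) ^ (-q)) *
        (Metric.ball x (2 ^ j * R)).indicator u y ≤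
      ENNReal.ofReal (2 ^ q * R ^ (s - q)) * ENNReal.ofReal ρ ^ j := by
    intro j
    rw [lintegral_const_mul _ (hu.indicator Metric.isOpen_ball.measurableSet),
      lintegral_indicator Metric.isOpen_ball.measurableSet]
    refine (mul_le_mul_right (hball x _ (by positivity)) _).trans_eq ?_
    rw [← ENNReal.ofReal_pow hρ0.le, ← ENNReal.ofReal_mul (by positivity),
      ← ENNReal.ofReal_mul (by positivity)]
    congr 1
    rw [mul_assoc, ← Real.rpow_add (by positivity), hρ, Real.mul_rpow (by positivity) hR.le,
      ← Real.rpow_natCast, ← Real.rpow_natCast, ← Real.rpow_mul (by norm_num),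
      ← Real.rpow_mul (by norm_num), show (j : ℝ) * (-q + s) = (s - q) * j by ring,
      show -q + s = s - q by ring]
    ring
  refine (ENNReal.tsum_le_tsum hj).trans_eq ?_
  rw [ENNReal.tsum_mul_left, ENNReal.tsum_geometric, ← ENNReal.ofReal_one,
    ← ENNReal.ofReal_sub _ hρ0.le, ← ENNReal.ofReal_inv_of_pos h1ρ,
    ← ENNReal.ofReal_mul (by positivity)]
  congr 1; ring

end

/-! ### The form of `σ̂` on functions living on level sets of the weight -/

section
variable {n : ℕ}

lemma convForm_finset_sum_kernel {ι : Type*} (s : Finset ι)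
    {K : ι → EuclideanSpace ℝ (Fin n) → ℂ} (hK : ∀ i, Measurable (K i)) {C : ι → ℝ}
    (hC : ∀ i x, ‖K i x‖ ≤ C i) {h g : EuclideanSpace ℝ (Fin n) → ℂ}
    (hh : Integrable h) (hg : Integrable g) :
    convForm (fun x => ∑ i ∈ s, K i x) h g = ∑ i ∈ s, convForm (K i) h g := by
  unfold convForm
  simp_rw [Finset.sum_mul]
  exact integral_finsetSum s fun i _ => integrable_conv (hK i) (hC i) hh hg

/-- The part of `σ̂` left after removing the Gaussian pieces obeys the decay estimate with the
length scale `1` replaced by `R`. The power `n` makes it vanish to high order at the origin. -/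
lemma norm_fourierSphere_one_mul_le {C : ℝ} (hC0 : 0 < C) (hn : 1 ≤ n)
    (hC : ∀ x : EuclideanSpace ℝ (Fin n), ‖fourierSphere (fun _ => 1) x‖ ≤
      C * (max 1 ‖x‖) ^ (-(((n : ℝ) - 1) / 2))) {R : ℝ} (hR : 1 ≤ R)
    (x : EuclideanSpace ℝ (Fin n)) :
    ‖fourierSphere (fun _ => 1) x * (((1 - Real.exp (-(R ^ 2)⁻¹ * ‖x‖ ^ 2)) ^ n : ℝ) : ℂ)‖ ≤
      C * (max R ‖x‖) ^ (-(((n : ℝ) - 1) / 2)) := by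
  set q : ℝ := ((n : ℝ) - 1) / 2 with hq
  have hn1 : (1 : ℝ) ≤ n := by exact_mod_cast hn
  have hq0 : 0 ≤ q := by rw [hq]; linarith
  set E : ℝ := 1 - Real.exp (-(R ^ 2)⁻¹ * ‖x‖ ^ 2) with hE
  have hR0 : 0 < R := by linarith
  have hE0 : 0 ≤ E := by
    rw [hE, sub_nonneg, Real.exp_le_one_iff, neg_mul, neg_nonpos]; positivity
  have hE1 : E ≤ 1 := by rw [hE]; linarith [Real.exp_pos (-(R ^ 2)⁻¹ * ‖x‖ ^ 2)]
  rw [norm_mul, Complex.norm_real, Real.norm_eq_abs, abs_of_nonneg (by positivity)]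
  have hm0 : 0 < max 1 ‖x‖ := lt_max_of_lt_left one_pos
  rcases le_total R ‖x‖ with hx | hx
  · rw [max_eq_right hx, ← max_eq_right (hR.trans hx)]
    calc _ ≤ C * (max 1 ‖x‖) ^ (-q) * 1 := by
          gcongr
          · exact hC x
          · exact pow_le_one₀ hE0 hE1
      _ = _ := mul_one _
  · rw [max_eq_left hx]
    have h1 : E ≤ (‖x‖ / R) ^ 2 := by
      have := Real.add_one_le_exp (-(R ^ 2)⁻¹ * ‖x‖ ^ 2)
      rw [hE, div_pow, div_eq_inv_mul]; linarith
    have h2 : E ^ n ≤ (‖x‖ / R) ^ q := by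
      have h3 : ‖x‖ / R ≤ 1 := (div_le_one hR0).2 hx
      have h3' : 0 ≤ ‖x‖ / R := by positivity
      calc E ^ n ≤ ((‖x‖ / R) ^ 2) ^ n := by gcongr
        _ = (‖x‖ / R) ^ (2 * n) := by rw [pow_mul]
        _ = (‖x‖ / R) ^ ((2 * n : ℕ) : ℝ) := (Real.rpow_natCast _ _).symm
        _ ≤ _ := by
            refine Real.rpow_le_rpow_of_exponent_ge' h3' h3 hq0 ?_
            rw [hq]; push_cast; linarith
    calc _ ≤ C * (max 1 ‖x‖) ^ (-q) * (‖x‖ / R) ^ q := by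
          gcongr
          exact hC x
      _ = C * ((‖x‖ / max 1 ‖x‖) ^ q * R ^ (-q)) := by
          rw [Real.div_rpow (norm_nonneg _) hR0.le, Real.div_rpow (norm_nonneg _) hm0.le,
            Real.rpow_neg hm0.le, Real.rpow_neg hR0.le]
          ring
      _ ≤ C * (1 * R ^ (-q)) := by
          gcongr
          exact Real.rpow_le_one (by positivity) ((div_le_one hm0).2 (le_max_right _ _)) hq0
      _ = _ := by rw [one_mul]

/-- The kernel `σ̂` split at scale `R` into a combination of Gaussian pieces, bounded on `L²`, and a
remainder to which Schur's test applies. -/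
theorem exists_enorm_convForm_fourierSphere_le (hn : 2 ≤ n) : ∃ C : ℝ, 0 < C ∧
    ∀ R : ℝ, 1 ≤ R → ∀ t : ℝ≥0∞, t ≠ 0 → t ≠ ∞ → ∀ h g : EuclideanSpace ℝ (Fin n) → ℂ,
      Integrable h → Measurable h → Integrable g → Measurable g →
    ∀ H G v : EuclideanSpace ℝ (Fin n) → ℝ≥0∞, Measurable H → Measurable G → Measurable v →
    ∀ D S : ℝ≥0∞, (∀ x y, ‖h x‖ₑ * ‖g y‖ₑ ≤ D * (H x * v y + G y * v x)) →
      (∀ x, ∫⁻ y, ENNReal.ofReal ((max R ‖x - y‖) ^ (-(((n : ℝ) - 1) / 2))) * v y ≤ S) →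
      ‖convForm (fourierSphere fun _ => 1) h g‖ₑ ≤
        ENNReal.ofReal (C * R) * (t * (∫⁻ x, ‖h x‖ₑ ^ 2) + t⁻¹ * ∫⁻ x, ‖g x‖ₑ ^ 2) +
          ENNReal.ofReal C * (D * S) * ((∫⁻ x, H x) + ∫⁻ x, G x) := by
  obtain ⟨C₁, hC₁0, hC₁⟩ := exists_enorm_convForm_gaussian_le (n := n) (by omega)
  obtain ⟨C₂, hC₂0, hC₂⟩ := exists_norm_fourierSphere_one_le hn
  set q : ℝ := ((n : ℝ) - 1) / 2 with hq
  refine ⟨2 ^ n * C₁ + C₂, by positivity, ?_⟩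
  intro R hR t ht ht' h g hh hhm hg hgm H G v hH hG hv D S hD hS
  have hR0 : 0 < R := by linarith
  set b : ℝ := (R ^ 2)⁻¹ with hb
  have hb0 : 0 < b := by positivity
  have hcont : Continuous (fourierSphere (n := n) fun _ => 1) :=
    continuous_fourierSphere (integrable_const _)
  set M : ℝ := (surfaceMeasure n).real Set.univ with hM
  have hM0 : 0 ≤ M := measureReal_nonneg
  set X : ℝ≥0∞ := t * (∫⁻ x, ‖h x‖ₑ ^ 2) + t⁻¹ * ∫⁻ x, ‖g x‖ₑ ^ 2 with hX
  set P : ℕ → EuclideanSpace ℝ (Fin n) → ℂ := fun k x =>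
    fourierSphere (fun _ => 1) x * ((Real.exp (-(k * b) * ‖x‖ ^ 2) : ℝ) : ℂ) with hP
  set U : EuclideanSpace ℝ (Fin n) → ℂ := fun x =>
    fourierSphere (fun _ => 1) x * (((1 - Real.exp (-b * ‖x‖ ^ 2)) ^ n : ℝ) : ℂ) with hU
  have hPc : ∀ k, Continuous (P k) := fun k => by fun_prop
  have hUc : Continuous U := by fun_prop
  have hPb : ∀ k x, ‖P k x‖ ≤ M := by
    intro k x
    rw [hP, norm_mul, Complex.norm_real, Real.norm_eq_abs, abs_of_pos (Real.exp_pos _)]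
    refine (mul_le_of_le_one_right (norm_nonneg _) ?_).trans (norm_fourierSphere_one_le x)
    rw [Real.exp_le_one_iff, neg_mul, neg_nonpos]; positivity
  -- binomial expansion of `(1 - e^{-b|x|²})^n`
  have hsplit : ∀ x, U x = ∑ k ∈ Finset.range (n + 1),
      (((-1) ^ k * (n.choose k : ℝ) : ℝ) : ℂ) * P k x := by
    intro x
    have : (1 - Real.exp (-b * ‖x‖ ^ 2)) ^ n = ∑ k ∈ Finset.range (n + 1),
        (-1) ^ k * (n.choose k : ℝ) * Real.exp (-(k * b) * ‖x‖ ^ 2) := by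
      rw [sub_eq_neg_add, add_pow]
      refine Finset.sum_congr rfl fun k _ => ?_
      rw [neg_pow, ← Real.exp_nat_mul, one_pow, mul_one]
      rw [show (k : ℝ) * (-b * ‖x‖ ^ 2) = -(k * b) * ‖x‖ ^ 2 by ring]
      ring
    simp only [hU, hP, this]
    push_cast
    rw [Finset.mul_sum]
    refine Finset.sum_congr rfl fun k _ => ?_
    ring
  have hform : convForm U h g = ∑ k ∈ Finset.range (n + 1),
      (((-1) ^ k * (n.choose k : ℝ) : ℝ) : ℂ) * convForm (P k) h g := by
    have e : U = fun x => ∑ k ∈ Finset.range (n + 1),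
      (((-1) ^ k * (n.choose k : ℝ) : ℝ) : ℂ) * P k x := funext hsplit
    rw [e, convForm_finset_sum_kernel (K := fun k x =>
        (((-1) ^ k * (n.choose k : ℝ) : ℝ) : ℂ) * P k x)
      (C := fun k => ‖(((-1) ^ k * (n.choose k : ℝ) : ℝ) : ℂ)‖ * M) _
      (fun k => by have := (hPc k).measurable; fun_prop)
      (fun k x => by rw [norm_mul]; gcongr; exact hPb k x) hh hg]
    refine Finset.sum_congr rfl fun k _ => ?_
    rw [convForm, convForm, ← integral_const_mul]
    simp only [mul_assoc]
  have hP0 : P 0 = fourierSphere fun _ => 1 := by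
    funext x; simp [hP]
  rw [Finset.sum_range_succ', hP0] at hform
  simp only [pow_zero, Nat.choose_zero_right, Nat.cast_one, mul_one, Complex.ofReal_one,
    one_mul] at hform
  have hmain : convForm (fourierSphere fun _ => 1) h g = convForm U h g -
      ∑ k ∈ Finset.range n, (((-1) ^ (k + 1) * (n.choose (k + 1) : ℝ) : ℝ) : ℂ) *
        convForm (P (k + 1)) h g := by
    rw [hform]; ring
  have hlow : ∀ k : ℕ, ‖(((-1) ^ (k + 1) * (n.choose (k + 1) : ℝ) : ℝ) : ℂ) *
      convForm (P (k + 1)) h g‖ₑ ≤ (n.choose (k + 1) : ℝ≥0∞) * (ENNReal.ofReal (C₁ * R) * X) := by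
    intro k
    rw [enorm_mul]
    have e : ‖(((-1) ^ (k + 1) * (n.choose (k + 1) : ℝ) : ℝ) : ℂ)‖ₑ =
        (n.choose (k + 1) : ℝ≥0∞) := by
      rw [← ofReal_norm, Complex.norm_real, norm_mul, norm_pow, norm_neg, norm_one, one_pow,
        one_mul, Real.norm_natCast, ENNReal.ofReal_natCast]
    rw [e]
    gcongr
    refine (hC₁ (((k + 1 : ℕ) : ℝ) * b) (by positivity) t ht ht' h g hh hhm hg hgm).trans ?_
    gcongr
    have hbR : b ^ (-(1 / 2) : ℝ) = R := by
      rw [hb, Real.inv_rpow (by positivity), ← Real.rpow_neg (by positivity), neg_neg,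
        ← Real.sqrt_eq_rpow, Real.sqrt_sq hR0.le]
    rw [← hbR]
    refine Real.rpow_le_rpow_of_nonpos hb0 ?_ (by norm_num)
    refine le_mul_of_one_le_left hb0.le ?_
    push_cast; linarith [(Nat.cast_nonneg k : (0 : ℝ) ≤ k)]
  have hhigh : ‖convForm U h g‖ₑ ≤
      D * (ENNReal.ofReal C₂ * S) * ((∫⁻ x, H x) + ∫⁻ x, G x) := by
    refine enorm_convForm_le_of_schur (k := fun x => ENNReal.ofReal C₂ *
      ENNReal.ofReal ((max R ‖x‖) ^ (-q))) (by fun_prop) (fun x => by simp) ?_ hH hG hv hD ?_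
    · intro x
      rw [← ENNReal.ofReal_mul hC₂0.le, ← ofReal_norm]
      exact ENNReal.ofReal_le_ofReal
        (norm_fourierSphere_one_mul_le hC₂0 (by omega) hC₂ hR x)
    · intro x
      simp_rw [mul_assoc]
      rw [lintegral_const_mul _ (by fun_prop)]
      gcongr
      exact hS x
  have hsum : ∑ k ∈ Finset.range n, (n.choose (k + 1) : ℝ≥0∞) ≤ ENNReal.ofReal (2 ^ n) := by
    have h1 : ∑ k ∈ Finset.range n, n.choose (k + 1) ≤ 2 ^ n := by
      rw [← Nat.sum_range_choose n, Finset.sum_range_succ']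
      exact Nat.le_add_right _ _
    have h2 : ((∑ k ∈ Finset.range n, n.choose (k + 1) : ℕ) : ℝ≥0∞) ≤ ((2 ^ n : ℕ) : ℝ≥0∞) := by
      exact_mod_cast h1
    rw [show (2 ^ n : ℝ) = ((2 ^ n : ℕ) : ℝ) by push_cast; rfl, ENNReal.ofReal_natCast]
    exact_mod_cast h2
  calc ‖convForm (fourierSphere fun _ => 1) h g‖ₑ
      ≤ ‖convForm U h g‖ₑ + ∑ k ∈ Finset.range n,
          ‖(((-1) ^ (k + 1) * (n.choose (k + 1) : ℝ) : ℝ) : ℂ) * convForm (P (k + 1)) h g‖ₑ := by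
        rw [hmain]
        refine enorm_sub_le.trans ?_
        gcongr
        exact enorm_sum_le _ _
    _ ≤ D * (ENNReal.ofReal C₂ * S) * ((∫⁻ x, H x) + ∫⁻ x, G x) +
          ∑ k ∈ Finset.range n, (n.choose (k + 1) : ℝ≥0∞) * (ENNReal.ofReal (C₁ * R) * X) := by
        gcongr with k _
        exact hlow k
    _ ≤ D * (ENNReal.ofReal C₂ * S) * ((∫⁻ x, H x) + ∫⁻ x, G x) +
          ENNReal.ofReal (2 ^ n) * (ENNReal.ofReal (C₁ * R) * X) := by
        rw [← Finset.sum_mul]; gcongr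
    _ = ENNReal.ofReal (2 ^ n * C₁ * R) * X +
          ENNReal.ofReal C₂ * (D * S) * ((∫⁻ x, H x) + ∫⁻ x, G x) := by
        rw [mul_assoc ((2 : ℝ) ^ n), ENNReal.ofReal_mul (by positivity : (0 : ℝ) ≤ 2 ^ n)]
        ring
    _ ≤ _ := by
        gcongr
        · linarith
        · have : 0 ≤ 2 ^ n * C₁ := by positivity
          linarith

/-- At scale `1` no Gaussian pieces are needed. -/
theorem exists_enorm_convForm_fourierSphere_le_schur (hn : 2 ≤ n) : ∃ C : ℝ, 0 < C ∧
    ∀ h g : EuclideanSpace ℝ (Fin n) → ℂ,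
    ∀ H G v : EuclideanSpace ℝ (Fin n) → ℝ≥0∞, Measurable H → Measurable G → Measurable v →
    ∀ D S : ℝ≥0∞, (∀ x y, ‖h x‖ₑ * ‖g y‖ₑ ≤ D * (H x * v y + G y * v x)) →
      (∀ x, ∫⁻ y, ENNReal.ofReal ((max 1 ‖x - y‖) ^ (-(((n : ℝ) - 1) / 2))) * v y ≤ S) →
      ‖convForm (fourierSphere fun _ => 1) h g‖ₑ ≤
          ENNReal.ofReal C * (D * S) * ((∫⁻ x, H x) + ∫⁻ x, G x) := by
  obtain ⟨C, hC0, hC⟩ := exists_norm_fourierSphere_one_le hn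
  refine ⟨C, hC0, fun h g H G v hH hG hv D S hD hS => ?_⟩
  refine (enorm_convForm_le_of_schur (k := fun x => ENNReal.ofReal C *
      ENNReal.ofReal ((max 1 ‖x‖) ^ (-(((n : ℝ) - 1) / 2)))) (by fun_prop) (fun x => by simp) ?_
      hH hG hv hD (S := ENNReal.ofReal C * S) ?_).trans_eq (by ring)
  · intro x
    rw [← ENNReal.ofReal_mul hC0.le, ← ofReal_norm]
    exact ENNReal.ofReal_le_ofReal (hC x)
  · intro x
    simp_rw [mul_assoc]
    rw [lintegral_const_mul _ (by fun_prop)]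
    gcongr
    exact hS x

/-- The pointwise hypothesis of Schur's test for the densities `a² / w` and the weight `w^β`. -/
lemma mul_le_schur_weights {β w₁ w₂ D : ℝ} (h₁ : 0 < w₁) (h₂ : 0 < w₂) (hD : 0 < D)
    (hw : (w₁ * w₂) ^ (1 - β) ≤ D ^ 2) (a b : ℝ≥0∞) :
    a * b ≤ ENNReal.ofReal D * (a ^ 2 / ENNReal.ofReal w₁ * ENNReal.ofReal (w₂ ^ β) +
      b ^ 2 / ENNReal.ofReal w₂ * ENNReal.ofReal (w₁ ^ β)) := by
  set t : ℝ := D * w₂ ^ β / w₁ with ht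
  have ht0 : 0 < t := by positivity
  refine (ENNReal.mul_le_weighted_sq_add_sq (t := ENNReal.ofReal t) (by simpa using ht0)
    ENNReal.ofReal_ne_top a b).trans ?_
  rw [← ENNReal.ofReal_inv_of_pos ht0, mul_add]
  have h1 : t⁻¹ ≤ D * w₁ ^ β / w₂ := by
    rw [ht, inv_div, div_le_div_iff₀ (by positivity) h₂]
    rw [Real.mul_rpow h₁.le h₂.le, Real.rpow_sub h₁, Real.rpow_sub h₂, Real.rpow_one,
      Real.rpow_one, div_mul_div_comm, div_le_iff₀ (by positivity)] at hw
    linarith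
  have h2 : ENNReal.ofReal t = ENNReal.ofReal D * ENNReal.ofReal (w₂ ^ β) / ENNReal.ofReal w₁ := by
    rw [ht, ENNReal.ofReal_div_of_pos h₁, ENNReal.ofReal_mul hD.le]
  have h3 : ENNReal.ofReal t⁻¹ ≤
      ENNReal.ofReal D * ENNReal.ofReal (w₁ ^ β) / ENNReal.ofReal w₂ := by
    rw [← ENNReal.ofReal_mul hD.le, ← ENNReal.ofReal_div_of_pos h₂]
    exact ENNReal.ofReal_le_ofReal h1
  refine add_le_add (le_of_eq ?_) ((mul_le_mul_left h3 _).trans_eq ?_)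
  · rw [h2]; simp only [div_eq_mul_inv]; ring
  · simp only [div_eq_mul_inv]; ring

lemma convForm_finset_sum_sum {ι : Type*} (F : Finset ι)
    {K : EuclideanSpace ℝ (Fin n) → ℂ} (hK : Measurable K) {C : ℝ}
    (hC : ∀ x, ‖K x‖ ≤ C) {u : ι → EuclideanSpace ℝ (Fin n) → ℂ}
    (hu : ∀ i, Integrable (u i)) :
    convForm K (fun x => ∑ i ∈ F, u i x) (fun x => ∑ i ∈ F, u i x) =
      ∑ i ∈ F, ∑ j ∈ F, convForm K (u i) (u j) := by
  unfold convForm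
  simp_rw [map_sum, Finset.sum_mul_sum, Finset.mul_sum]
  rw [integral_finsetSum F fun i _ => integrable_finsetSum F fun j _ =>
    integrable_conv hK hC (hu i) (hu j)]
  refine Finset.sum_congr rfl fun i _ => ?_
  exact integral_finsetSum F fun j _ => integrable_conv hK hC (hu i) (hu j)

lemma summable_pow_natAbs {ρ : ℝ} (h0 : 0 ≤ ρ) (h1 : ρ < 1) :
    Summable fun m : ℤ => ρ ^ m.natAbs := by
  refine Summable.of_nat_of_neg ?_ ?_
  · simpa using summable_geometric_of_lt_one h0 h1
  · simpa using summable_geometric_of_lt_one h0 h1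

/-- A matrix `ρ^{|k + l|}` with `ρ < 1` acts boundedly on `ℓ²`. -/
lemma sum_sum_pow_natAbs_mul_le {ρ : ℝ} (h0 : 0 ≤ ρ) (h1 : ρ < 1) (F : Finset ℤ) (P : ℤ → ℝ≥0∞) :
    ∑ k ∈ F, ∑ l ∈ F, ENNReal.ofReal (ρ ^ (k + l).natAbs) * (P k + P l) ≤
      ENNReal.ofReal (2 * ∑' m : ℤ, ρ ^ m.natAbs) * ∑ k ∈ F, P k := by
  have hrow : ∀ k : ℤ, ∑ l ∈ F, ENNReal.ofReal (ρ ^ (k + l).natAbs) ≤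
      ENNReal.ofReal (∑' m : ℤ, ρ ^ m.natAbs) := by
    intro k
    rw [ENNReal.ofReal_tsum_of_nonneg (fun m => by positivity) (summable_pow_natAbs h0 h1),
      ← (Equiv.addLeft k).tsum_eq]
    exact ENNReal.sum_le_tsum F
  have hone : ∑ k ∈ F, ∑ l ∈ F, ENNReal.ofReal (ρ ^ (k + l).natAbs) * P k ≤
      ENNReal.ofReal (∑' m : ℤ, ρ ^ m.natAbs) * ∑ k ∈ F, P k := by
    rw [Finset.mul_sum]
    refine Finset.sum_le_sum fun k _ => ?_
    rw [← Finset.sum_mul]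
    gcongr
    exact hrow k
  simp_rw [mul_add, Finset.sum_add_distrib]
  have hsymm : ∑ k ∈ F, ∑ l ∈ F, ENNReal.ofReal (ρ ^ (k + l).natAbs) * P l =
      ∑ k ∈ F, ∑ l ∈ F, ENNReal.ofReal (ρ ^ (k + l).natAbs) * P k := by
    rw [Finset.sum_comm]
    simp_rw [add_comm]
  rw [hsymm, ENNReal.ofReal_mul zero_le_two, ENNReal.ofReal_ofNat, mul_assoc, two_mul]
  exact add_le_add hone hone

/-- For functions supported where `w ≈ 2ᵏ` and `w ≈ 2ˡ`, the form of `σ̂` gains a power of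
`2^{|k + l|}` if `β > 1`. For `k + l < 0` the splitting scale `R = 2^{-τ(k + l)}` balances the low
part, of norm `R 2^{(k + l)/2}`, against the remainder, of norm `R^{s - q} 2^{(1 - β)(k + l)/2}`. -/
theorem exists_enorm_convForm_levels_le (hn : 2 ≤ n) {β s : ℝ} (hβ : 1 < β)
    (hs : s + (β - 1) < ((n : ℝ) - 1) / 2) : ∃ C ρ : ℝ, 0 < C ∧ 0 < ρ ∧ ρ < 1 ∧
    ∀ w : EuclideanSpace ℝ (Fin n) → ℝ, Measurable w →
      (∀ (x : EuclideanSpace ℝ (Fin n)) (r : ℝ), 0 < r →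
        ∫⁻ y in Metric.ball x r, ENNReal.ofReal (w y ^ β) ≤ ENNReal.ofReal (r ^ s)) →
    ∀ (k l : ℤ) (h g : EuclideanSpace ℝ (Fin n) → ℂ),
      Integrable h → Measurable h → Integrable g → Measurable g →
      (∀ x, h x ≠ 0 → (2 : ℝ) ^ k ≤ w x ∧ w x < (2 : ℝ) ^ (k + 1)) →
      (∀ x, g x ≠ 0 → (2 : ℝ) ^ l ≤ w x ∧ w x < (2 : ℝ) ^ (l + 1)) →
      ‖convForm (fourierSphere fun _ => 1) h g‖ₑ ≤ ENNReal.ofReal (C * ρ ^ (k + l).natAbs) *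
        ((∫⁻ x, ‖h x‖ₑ ^ 2 / ENNReal.ofReal (w x)) +
          ∫⁻ x, ‖g x‖ₑ ^ 2 / ENNReal.ofReal (w x)) := by
  obtain ⟨C₁, hC₁0, hC₁⟩ := exists_enorm_convForm_fourierSphere_le hn
  obtain ⟨C₂, hC₂0, hC₂⟩ := exists_enorm_convForm_fourierSphere_le_schur hn
  set q : ℝ := ((n : ℝ) - 1) / 2 with hq
  have hq0 : 0 ≤ q := by
    have : (2 : ℝ) ≤ n := by exact_mod_cast hn
    rw [hq]; linarith
  have hsq : s < q := by linarith
  obtain ⟨C₃, hC₃0, hC₃⟩ := exists_lintegral_kernel_le (n := n) hsq hq0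
  set p : ℝ := q - s with hp
  have hp0 : 0 < p := by linarith
  have hpβ : β - 1 < p := by linarith
  -- `τ` lies strictly between `(β - 1) / (2 p)` and `1 / 2`
  set τ : ℝ := ((β - 1) / p + 1) / 4 with hτ
  have hratio : (β - 1) / p < 1 := (div_lt_one hp0).2 hpβ
  have hratio0 : 0 < (β - 1) / p := div_pos (by linarith) hp0
  have hpr : p * ((β - 1) / p) = β - 1 := by field_simp
  have hτ0 : 0 < τ := by positivity
  have hτ1 : 0 < 1 / 2 - τ := by rw [hτ]; linarith
  have hτ2 : 0 < p * τ - (β - 1) / 2 := by rw [hτ]; nlinarith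
  set δ : ℝ := min ((β - 1) / 2) (min (1 / 2 - τ) (p * τ - (β - 1) / 2)) with hδ
  have hδ0 : 0 < δ := lt_min (by linarith) (lt_min hτ1 hτ2)
  have hδ1 : δ ≤ (β - 1) / 2 := min_le_left _ _
  have hδ2 : δ ≤ 1 / 2 - τ := (min_le_right _ _).trans (min_le_left _ _)
  have hδ3 : δ ≤ p * τ - (β - 1) / 2 := (min_le_right _ _).trans (min_le_right _ _)
  set ρ : ℝ := 2 ^ (-δ) with hρ
  refine ⟨2 * C₁ + C₁ * C₃ + C₂ * C₃, ρ, by positivity, by positivity,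
    Real.rpow_lt_one_of_one_lt_of_neg one_lt_two (by linarith), ?_⟩
  intro w hw hball k l h g hh hhm hg hgm hhk hgl
  set H : EuclideanSpace ℝ (Fin n) → ℝ≥0∞ := fun x => ‖h x‖ₑ ^ 2 / ENNReal.ofReal (w x) with hH
  set G : EuclideanSpace ℝ (Fin n) → ℝ≥0∞ := fun x => ‖g x‖ₑ ^ 2 / ENNReal.ofReal (w x) with hG
  have hHm : Measurable H := by fun_prop
  have hGm : Measurable G := by fun_prop
  have hvm : Measurable fun x => ENNReal.ofReal (w x ^ β) := by fun_prop
  set D : ℝ := 2 ^ ((1 - β) / 2 * ((k + l : ℤ) : ℝ)) with hD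
  have hD0 : 0 < D := by positivity
  have hschur : ∀ x y, ‖h x‖ₑ * ‖g y‖ₑ ≤ ENNReal.ofReal D *
      (H x * ENNReal.ofReal (w y ^ β) + G y * ENNReal.ofReal (w x ^ β)) := by
    intro x y
    by_cases hx : h x = 0
    · simp [hx]
    by_cases hy : g y = 0
    · simp [hy]
    have h1 := (hhk x hx).1
    have h2 := (hgl y hy).1
    have h3 : (0 : ℝ) < 2 ^ k := by positivity
    have h4 : (0 : ℝ) < 2 ^ l := by positivity
    refine mul_le_schur_weights (h3.trans_le h1) (h4.trans_le h2) hD0 ?_ _ _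
    calc (w x * w y) ^ (1 - β) ≤ ((2 : ℝ) ^ k * 2 ^ l) ^ (1 - β) := by
          refine Real.rpow_le_rpow_of_nonpos (by positivity) ?_ (by linarith)
          exact mul_le_mul h1 h2 h4.le (h3.le.trans h1)
      _ = D ^ 2 := by
          rw [← zpow_add₀ two_ne_zero, ← Real.rpow_intCast, ← Real.rpow_mul zero_le_two, hD,
            ← Real.rpow_natCast, ← Real.rpow_mul zero_le_two]
          congr 1; push_cast; ring
  have hρpow : ρ ^ (k + l).natAbs = 2 ^ (-δ * |((k + l : ℤ) : ℝ)|) := by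
    rw [hρ, ← Real.rpow_natCast, ← Real.rpow_mul zero_le_two, Nat.cast_natAbs, Int.cast_abs]
  rcases le_or_gt 0 (k + l) with hkl | hkl
  · have hm : (0 : ℝ) ≤ ((k + l : ℤ) : ℝ) := by exact_mod_cast hkl
    have hS := hC₃ _ hvm hball 1 one_pos
    rw [Real.one_rpow, mul_one] at hS
    refine (hC₂ h g H G _ hHm hGm hvm _ _ hschur hS).trans ?_
    gcongr
    rw [← ENNReal.ofReal_mul hD0.le, ← ENNReal.ofReal_mul hC₂0.le]
    apply ENNReal.ofReal_le_ofReal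
    have hDρ : D ≤ ρ ^ (k + l).natAbs := by
      rw [hρpow, abs_of_nonneg hm]
      refine Real.rpow_le_rpow_of_exponent_le one_le_two ?_
      nlinarith
    have : 0 ≤ 2 * C₁ + C₁ * C₃ := by positivity
    calc C₂ * (D * C₃) ≤ C₂ * (ρ ^ (k + l).natAbs * C₃) := by gcongr
      _ = (C₂ * C₃) * ρ ^ (k + l).natAbs := by ring
      _ ≤ _ := by gcongr; linarith
  · have hm : ((k + l : ℤ) : ℝ) < 0 := by exact_mod_cast hkl
    set M : ℝ := ((k + l : ℤ) : ℝ) with hM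
    set R : ℝ := 2 ^ (-τ * M) with hR
    have hR1 : 1 ≤ R := Real.one_le_rpow one_le_two (by nlinarith)
    have hR0 : 0 < R := by linarith
    set t : ℝ := 2 ^ (((l : ℝ) - k) / 2) with ht
    have ht0 : 0 < t := by positivity
    have hS := hC₃ _ hvm hball R hR0
    refine (hC₁ R hR1 (ENNReal.ofReal t) (by simpa using ht0) ENNReal.ofReal_ne_top h g hh hhm hg
      hgm H G _ hHm hGm hvm _ _ hschur hS).trans ?_
    -- on each level the `L²` norm is comparable with the weighted one
    have hL2 : ∀ (j : ℤ) (f : EuclideanSpace ℝ (Fin n) → ℂ), Measurable f →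
        (∀ x, f x ≠ 0 → (2 : ℝ) ^ j ≤ w x ∧ w x < (2 : ℝ) ^ (j + 1)) →
        ∫⁻ x, ‖f x‖ₑ ^ 2 ≤
          ENNReal.ofReal (2 * 2 ^ (j : ℝ)) * ∫⁻ x, ‖f x‖ₑ ^ 2 / ENNReal.ofReal (w x) := by
      intro j f hf hfj
      rw [← lintegral_const_mul _ (by fun_prop)]
      refine lintegral_mono fun x => ?_
      by_cases hx : f x = 0
      · simp [hx]
      obtain ⟨h1, h2⟩ := hfj x hx
      have hw0 : 0 < w x := lt_of_lt_of_le (by positivity) h1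
      have e : ‖f x‖ₑ ^ 2 = ENNReal.ofReal (w x) * (‖f x‖ₑ ^ 2 / ENNReal.ofReal (w x)) :=
        (ENNReal.mul_div_cancel (by simpa using hw0) ENNReal.ofReal_ne_top).symm
      refine e.le.trans ?_
      gcongr
      rw [zpow_add_one₀ two_ne_zero, ← Real.rpow_intCast] at h2
      linarith
    have h1 : ENNReal.ofReal t * (∫⁻ x, ‖h x‖ₑ ^ 2) ≤
        ENNReal.ofReal (2 * 2 ^ (M / 2)) * ∫⁻ x, H x := by
      refine (mul_le_mul_right (hL2 k h hhm hhk) _).trans_eq ?_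
      rw [← mul_assoc, ← ENNReal.ofReal_mul ht0.le, ht, mul_left_comm,
        ← Real.rpow_add two_pos]
      congr 4
      rw [hM]; push_cast; ring
    have h2 : (ENNReal.ofReal t)⁻¹ * (∫⁻ x, ‖g x‖ₑ ^ 2) ≤
        ENNReal.ofReal (2 * 2 ^ (M / 2)) * ∫⁻ x, G x := by
      refine (mul_le_mul_right (hL2 l g hgm hgl) _).trans_eq ?_
      rw [← ENNReal.ofReal_inv_of_pos ht0, ← mul_assoc, ← ENNReal.ofReal_mul (by positivity), ht,
        ← Real.rpow_neg zero_le_two, mul_left_comm, ← Real.rpow_add two_pos]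
      congr 4
      rw [hM]; push_cast; ring
    have hlow : R * 2 ^ (M / 2) ≤ ρ ^ (k + l).natAbs := by
      rw [hρpow, hR, ← Real.rpow_add two_pos, abs_of_neg hm]
      refine Real.rpow_le_rpow_of_exponent_le one_le_two ?_
      nlinarith
    have hhigh : D * R ^ (s - q) ≤ ρ ^ (k + l).natAbs := by
      rw [hρpow, hR, ← Real.rpow_mul zero_le_two, hD, ← Real.rpow_add two_pos, abs_of_neg hm]
      refine Real.rpow_le_rpow_of_exponent_le one_le_two ?_
      rw [show s - q = -p by rw [hp]; ring]
      nlinarith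
    have hX : 0 ≤ C₂ * C₃ := by positivity
    calc _ ≤ ENNReal.ofReal (C₁ * R) * (ENNReal.ofReal (2 * 2 ^ (M / 2)) * (∫⁻ x, H x) +
          ENNReal.ofReal (2 * 2 ^ (M / 2)) * ∫⁻ x, G x) +
          ENNReal.ofReal C₁ * (ENNReal.ofReal D * ENNReal.ofReal (C₃ * R ^ (s - q))) *
            ((∫⁻ x, H x) + ∫⁻ x, G x) := by gcongr
      _ = ENNReal.ofReal (C₁ * R * (2 * 2 ^ (M / 2)) + C₁ * (D * (C₃ * R ^ (s - q)))) *
            ((∫⁻ x, H x) + ∫⁻ x, G x) := by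
          rw [ENNReal.ofReal_add (by positivity) (by positivity),
            ENNReal.ofReal_mul (p := C₁ * R) (by positivity),
            ENNReal.ofReal_mul hC₁0.le (q := D * _),
            ENNReal.ofReal_mul hD0.le]
          ring
      _ ≤ _ := by
          gcongr
          calc C₁ * R * (2 * 2 ^ (M / 2)) + C₁ * (D * (C₃ * R ^ (s - q)))
              = 2 * C₁ * (R * 2 ^ (M / 2)) + C₁ * C₃ * (D * R ^ (s - q)) := by ring
            _ ≤ 2 * C₁ * ρ ^ (k + l).natAbs + C₁ * C₃ * ρ ^ (k + l).natAbs := by gcongr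
            _ = (2 * C₁ + C₁ * C₃) * ρ ^ (k + l).natAbs := by ring
            _ ≤ _ := mul_le_mul_of_nonneg_right (by linarith) (by positivity)

/-- The weighted bound `∫∫ u(x) conj(u(y)) σ̂(x - y) ≤ C ∫ |u|² / w`, dual to the restriction
estimate. -/
theorem exists_enorm_convForm_self_le (hn : 2 ≤ n) {β s : ℝ} (hβ : 1 ≤ β)
    (hs : s + (β - 1) < ((n : ℝ) - 1) / 2) : ∃ C : ℝ, 0 < C ∧
    ∀ w : EuclideanSpace ℝ (Fin n) → ℝ, Measurable w →
      (∀ (x : EuclideanSpace ℝ (Fin n)) (r : ℝ), 0 < r →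
        ∫⁻ y in Metric.ball x r, ENNReal.ofReal (w y ^ β) ≤ ENNReal.ofReal (r ^ s)) →
    ∀ (u : EuclideanSpace ℝ (Fin n) → ℂ) (N : ℤ), Integrable u → Measurable u →
      (∀ x, u x ≠ 0 → (2 : ℝ) ^ (-N) ≤ w x ∧ w x < (2 : ℝ) ^ N) →
      ‖convForm (fourierSphere fun _ => 1) u u‖ₑ ≤
        ENNReal.ofReal C * ∫⁻ x, ‖u x‖ₑ ^ 2 / ENNReal.ofReal (w x) := by
  rcases hβ.eq_or_lt with rfl | hβ
  · -- for `β = 1` Schur's test applies without splitting anything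
    obtain ⟨C₂, hC₂0, hC₂⟩ := exists_enorm_convForm_fourierSphere_le_schur hn
    have hq0 : 0 ≤ ((n : ℝ) - 1) / 2 := by
      have : (2 : ℝ) ≤ n := by exact_mod_cast hn
      linarith
    obtain ⟨C₃, hC₃0, hC₃⟩ := exists_lintegral_kernel_le (n := n)
      (show s < ((n : ℝ) - 1) / 2 by linarith) hq0
    refine ⟨C₂ * C₃ * 2, by positivity, fun w hw hball u N hu hum huw => ?_⟩
    have hvm : Measurable fun x => ENNReal.ofReal (w x ^ (1 : ℝ)) := by fun_prop
    have hS := hC₃ _ hvm hball 1 one_pos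
    rw [Real.one_rpow, mul_one] at hS
    have hHm : Measurable fun x => ‖u x‖ₑ ^ 2 / ENNReal.ofReal (w x) := by fun_prop
    refine (hC₂ u u _ _ _ hHm hHm hvm (ENNReal.ofReal 1) _ (fun x y => ?_) hS).trans_eq ?_
    · by_cases hx : u x = 0
      · simp [hx]
      by_cases hy : u y = 0
      · simp [hy]
      have h3 : (0 : ℝ) < 2 ^ (-N) := by positivity
      exact mul_le_schur_weights (h3.trans_le (huw x hx).1) (h3.trans_le (huw y hy).1) one_pos
        (by simp) _ _
    · rw [ENNReal.ofReal_mul (by positivity), ENNReal.ofReal_mul hC₂0.le, ENNReal.ofReal_one,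
        ENNReal.ofReal_ofNat]
      ring
  · obtain ⟨C, ρ, hC0, hρ0, hρ1, hC⟩ := exists_enorm_convForm_levels_le hn hβ hs
    have hA0 : 0 ≤ ∑' m : ℤ, ρ ^ m.natAbs := tsum_nonneg fun m => by positivity
    refine ⟨C * (2 * ∑' m : ℤ, ρ ^ m.natAbs) + 1, by positivity,
      fun w hw hball u N hu hum huw => ?_⟩
    set L : ℤ → Set (EuclideanSpace ℝ (Fin n)) :=
      fun k => {x | (2 : ℝ) ^ k ≤ w x ∧ w x < (2 : ℝ) ^ (k + 1)} with hL
    have hLm : ∀ k, MeasurableSet (L k) := fun k =>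
      (measurableSet_le measurable_const hw).inter (measurableSet_lt hw measurable_const)
    have hLiff : ∀ k x, 0 < w x → (x ∈ L k ↔ Int.log 2 (w x) = k) := by
      intro k x hx
      have h1 := Int.zpow_le_iff_le_log (b := 2) (x := k) one_lt_two hx
      have h2 := Int.lt_zpow_iff_log_lt (b := 2) (x := k + 1) one_lt_two hx
      push_cast at h1 h2
      rw [hL, Set.mem_ofPred_eq, h1, h2]
      omega
    have hLpos : ∀ k x, x ∈ L k → 0 < w x := fun k x hx => lt_of_lt_of_le (by positivity) hx.1
    set F : Finset ℤ := Finset.Ico (-N) N with hF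
    set U : ℤ → EuclideanSpace ℝ (Fin n) → ℂ := fun k => (L k).indicator u with hU
    have hUi : ∀ k, Integrable (U k) := fun k => hu.indicator (hLm k)
    have hUm : ∀ k, Measurable (U k) := fun k => hum.indicator (hLm k)
    have hUL : ∀ k x, U k x ≠ 0 → (2 : ℝ) ^ k ≤ w x ∧ w x < (2 : ℝ) ^ (k + 1) := by
      intro k x hx
      by_contra hmem
      exact hx (Set.indicator_of_notMem (show x ∉ L k from hmem) _)
    have hdecomp : u = fun x => ∑ k ∈ F, U k x := by
      funext x
      by_cases hx : u x = 0
      · rw [hx]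
        refine (Finset.sum_eq_zero fun k _ => ?_).symm
        rw [hU, Set.indicator_apply_eq_zero]
        exact fun _ => hx
      · obtain ⟨h1, h2⟩ := huw x hx
        have hw0 : 0 < w x := lt_of_lt_of_le (by positivity) h1
        have h3 : Int.log 2 (w x) ∈ F := by
          have h3 := Int.zpow_le_iff_le_log (b := 2) (x := -N) one_lt_two hw0
          have h4 := Int.lt_zpow_iff_log_lt (b := 2) (x := N) one_lt_two hw0
          push_cast at h3 h4
          rw [hF, Finset.mem_Ico]
          exact ⟨h3.1 h1, h4.1 h2⟩
        rw [Finset.sum_eq_single_of_mem _ h3]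
        · rw [hU]
          exact (Set.indicator_of_mem ((hLiff _ x hw0).2 rfl) _).symm
        · intro k _ hk
          rw [hU]
          exact Set.indicator_of_notMem (fun hmem => hk ((hLiff _ x hw0).1 hmem).symm) _
    set P : ℤ → ℝ≥0∞ := fun k => ∫⁻ x, ‖U k x‖ₑ ^ 2 / ENNReal.ofReal (w x) with hP
    have hPsum : ∑ k ∈ F, P k ≤ ∫⁻ x, ‖u x‖ₑ ^ 2 / ENNReal.ofReal (w x) := by
      have hPm : ∀ k, Measurable fun x => ‖U k x‖ₑ ^ 2 / ENNReal.ofReal (w x) := fun k => by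
        have := hUm k
        fun_prop
      rw [hP, ← lintegral_finsetSum _ fun k _ => hPm k]
      refine lintegral_mono fun x => ?_
      rcases le_or_gt (w x) 0 with hw0 | hw0
      · refine (Finset.sum_eq_zero fun k _ => ?_).le.trans zero_le
        have : U k x = 0 := Set.indicator_of_notMem (fun hmem => (hLpos k x hmem).not_ge hw0) _
        simp [this]
      · calc ∑ k ∈ F, ‖U k x‖ₑ ^ 2 / ENNReal.ofReal (w x)
            ≤ ∑ k ∈ F, if Int.log 2 (w x) = k then ‖u x‖ₑ ^ 2 / ENNReal.ofReal (w x) else 0 := by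
              refine Finset.sum_le_sum fun k _ => ?_
              split_ifs with hk
              · rw [hU]
                gcongr
                exact enorm_indicator_le_enorm_self _ _
              · have : U k x = 0 :=
                  Set.indicator_of_notMem (fun hmem => hk ((hLiff k x hw0).1 hmem)) _
                simp [this]
          _ ≤ _ := by
              rw [Finset.sum_ite_eq]
              split_ifs
              · exact le_rfl
              · exact zero_le
    have hcont : Continuous (fourierSphere (n := n) fun _ => 1) :=
      continuous_fourierSphere (integrable_const _)
    calc ‖convForm (fourierSphere fun _ => 1) u u‖ₑ
        = ‖∑ k ∈ F, ∑ l ∈ F, convForm (fourierSphere fun _ => 1) (U k) (U l)‖ₑ := by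
          rw [← convForm_finset_sum_sum F hcont.measurable norm_fourierSphere_one_le hUi, ← hdecomp]
      _ ≤ ∑ k ∈ F, ∑ l ∈ F, ‖convForm (fourierSphere fun _ => 1) (U k) (U l)‖ₑ :=
          (enorm_sum_le _ _).trans (Finset.sum_le_sum fun k _ => enorm_sum_le _ _)
      _ ≤ ∑ k ∈ F, ∑ l ∈ F, ENNReal.ofReal C *
            (ENNReal.ofReal (ρ ^ (k + l).natAbs) * (P k + P l)) := by
          refine Finset.sum_le_sum fun k _ => Finset.sum_le_sum fun l _ => ?_
          rw [← mul_assoc, ← ENNReal.ofReal_mul hC0.le]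
          exact hC w hw hball k l _ _ (hUi k) (hUm k) (hUi l) (hUm l) (hUL k) (hUL l)
      _ = ENNReal.ofReal C *
            ∑ k ∈ F, ∑ l ∈ F, ENNReal.ofReal (ρ ^ (k + l).natAbs) * (P k + P l) := by
          simp_rw [Finset.mul_sum]
      _ ≤ ENNReal.ofReal C * (ENNReal.ofReal (2 * ∑' m : ℤ, ρ ^ m.natAbs) *
            ∫⁻ x, ‖u x‖ₑ ^ 2 / ENNReal.ofReal (w x)) := by
          gcongr
          refine (sum_sum_pow_natAbs_mul_le hρ0.le hρ1 F P).trans ?_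
          gcongr
      _ ≤ _ := by
          rw [← mul_assoc, ← ENNReal.ofReal_mul hC0.le]
          gcongr
          linarith

/-! ### Duality and conclusion -/

/-- Exchanging the two integrations: `fourierSphere` and `waveTransform` are transposes. -/
lemma integral_fourierSphere_mul {f : Metric.sphere (0 : EuclideanSpace ℝ (Fin n)) 1 → ℂ}
    (hf : Integrable f (surfaceMeasure n)) {u : EuclideanSpace ℝ (Fin n) → ℂ} (hu : Integrable u) :
    ∫ x, fourierSphere f x * u x =
      ∫ ω, f ω * waveTransform u (ω : EuclideanSpace ℝ (Fin n)) ∂(surfaceMeasure n) := by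
  have hint : Integrable (fun p : EuclideanSpace ℝ (Fin n) ×
      Metric.sphere (0 : EuclideanSpace ℝ (Fin n)) 1 =>
      planeWave p.1 (p.2 : EuclideanSpace ℝ (Fin n)) * (u p.1 * f p.2))
      (volume.prod (surfaceMeasure n)) := by
    refine (hu.mul_prod hf).bdd_mul (c := 1) ?_ (Filter.Eventually.of_forall fun p =>
      (norm_planeWave _ _).le)
    exact Measurable.aestronglyMeasurable (by fun_prop)
  have h := integral_integral_swap
    (f := fun x (ω : Metric.sphere (0 : EuclideanSpace ℝ (Fin n)) 1) =>
    planeWave x (ω : EuclideanSpace ℝ (Fin n)) * (u x * f ω)) hint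
  refine Eq.trans (integral_congr_ae (Filter.Eventually.of_forall fun x => ?_))
    (h.trans (integral_congr_ae (Filter.Eventually.of_forall fun ω => ?_)))
  · simp only [fourierSphere]
    rw [← integral_mul_const]
    refine integral_congr_ae (Filter.Eventually.of_forall fun ω => ?_)
    simp only [planeWave]; ring
  · simp only [waveTransform]
    rw [← integral_const_mul]
    refine integral_congr_ae (Filter.Eventually.of_forall fun x => ?_)
    simp only; ring

/-- The estimate for normalised weights. -/
theorem exists_lintegral_fourierSphere_sq_le (hn : 2 ≤ n) {β s : ℝ} (hβ : 1 ≤ β)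
    (hs : s + (β - 1) < ((n : ℝ) - 1) / 2) : ∃ C : ℝ, 0 < C ∧
    ∀ w : EuclideanSpace ℝ (Fin n) → ℝ, Measurable w →
      (∀ (x : EuclideanSpace ℝ (Fin n)) (r : ℝ), 0 < r →
        ∫⁻ y in Metric.ball x r, ENNReal.ofReal (w y ^ β) ≤ ENNReal.ofReal (r ^ s)) →
    ∀ f : Metric.sphere (0 : EuclideanSpace ℝ (Fin n)) 1 → ℂ, MemLp f 2 (surfaceMeasure n) →
      ∫⁻ x, ‖fourierSphere f x‖ₑ ^ 2 * ENNReal.ofReal (w x) ≤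
        ENNReal.ofReal C * ∫⁻ ω, ‖f ω‖ₑ ^ 2 ∂(surfaceMeasure n) := by
  obtain ⟨C, hC0, hC⟩ := exists_enorm_convForm_self_le hn hβ hs
  refine ⟨4 * C, by positivity, fun w hw hball f hf => ?_⟩
  have hfi : Integrable f (surfaceMeasure n) := hf.integrable one_le_two
  have hFc := continuous_fourierSphere hfi
  set F := fourierSphere f with hF
  set M : ℝ := ∫ ω, ‖f ω‖ ∂(surfaceMeasure n) with hM
  have hFM : ∀ x, ‖F x‖ ≤ M := by
    intro x
    refine (norm_integral_le_integral_norm _).trans_eq (integral_congr_ae ?_)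
    exact Filter.Eventually.of_forall fun ω => by simp [Complex.norm_exp]
  set A : ℕ → Set (EuclideanSpace ℝ (Fin n)) := fun N =>
    Metric.ball 0 N ∩ {x | (2 : ℝ) ^ (-(N : ℤ)) ≤ w x ∧ w x < (2 : ℝ) ^ (N : ℤ)} with hA
  have hAm : ∀ N, MeasurableSet (A N) := fun N => Metric.isOpen_ball.measurableSet.inter
    ((measurableSet_le measurable_const hw).inter (measurableSet_lt hw measurable_const))
  have hAw : ∀ N, ∀ x ∈ A N, 0 < w x := fun N x hx => lt_of_lt_of_le (by positivity) hx.2.1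
  set g : EuclideanSpace ℝ (Fin n) → ℝ≥0∞ := fun x => ‖F x‖ₑ ^ 2 * ENNReal.ofReal (w x) with hg
  have hgm : Measurable g := by
    have := hFc.measurable
    fun_prop
  have hbound : ∀ N, ∫⁻ x, (A N).indicator g x ≤
      ENNReal.ofReal (4 * C) * ∫⁻ ω, ‖f ω‖ₑ ^ 2 ∂(surfaceMeasure n) := by
    intro N
    set X : ℝ≥0∞ := ∫⁻ x, (A N).indicator g x with hX
    set r : EuclideanSpace ℝ (Fin n) → ℝ := (A N).indicator fun x => ‖F x‖ ^ 2 * w x with hr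
    set u : EuclideanSpace ℝ (Fin n) → ℂ :=
      (A N).indicator fun x => (starRingEnd ℂ) (F x) * (w x : ℂ) with hu
    have hfin : volume (A N) ≠ ∞ :=
      (lt_of_le_of_lt (measure_mono Set.inter_subset_left) measure_ball_lt_top).ne
    have hM0 : 0 ≤ M := integral_nonneg fun _ => norm_nonneg _
    have hum : Measurable u := by
      refine Measurable.indicator ?_ (hAm N)
      have h1 := hFc.measurable
      have h2 : Measurable fun x => (starRingEnd ℂ) (F x) :=
        Complex.continuous_conj.measurable.comp h1
      fun_prop
    have hui : Integrable u := by
      rw [hu, integrable_indicator_iff (hAm N)]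
      refine Measure.integrableOn_of_bounded (M := M * 2 ^ (N : ℤ)) hfin ?_ ?_
      · have h2 : Measurable fun x => (starRingEnd ℂ) (F x) :=
          Complex.continuous_conj.measurable.comp hFc.measurable
        exact Measurable.aestronglyMeasurable (by fun_prop)
      · refine (ae_restrict_iff' (hAm N)).2 (Filter.Eventually.of_forall fun x hx => ?_)
        rw [norm_mul, Complex.norm_conj, Complex.norm_real, Real.norm_eq_abs,
          abs_of_pos (hAw N x hx)]
        exact mul_le_mul (hFM x) hx.2.2.le (hAw N x hx).le hM0
    have hri : Integrable r := by
      rw [hr, integrable_indicator_iff (hAm N)]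
      refine Measure.integrableOn_of_bounded (M := M ^ 2 * 2 ^ (N : ℤ)) hfin ?_ ?_
      · have := hFc.measurable
        exact Measurable.aestronglyMeasurable (by fun_prop)
      · refine (ae_restrict_iff' (hAm N)).2 (Filter.Eventually.of_forall fun x hx => ?_)
        have := hAw N x hx
        rw [Real.norm_eq_abs, abs_of_nonneg (by positivity)]
        exact mul_le_mul (pow_le_pow_left₀ (norm_nonneg _) (hFM x) 2) hx.2.2.le this.le
          (by positivity)
    have hr0 : ∀ x, 0 ≤ r x := Set.indicator_nonneg fun x hx => by
      have := hAw N x hx; positivity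
    have hXr : X = ∫⁻ x, ENNReal.ofReal (r x) := by
      refine lintegral_congr fun x => ?_
      by_cases hx : x ∈ A N
      · rw [hr, Set.indicator_of_mem hx, Set.indicator_of_mem hx, hg,
          ENNReal.ofReal_mul (by positivity), ENNReal.ofReal_pow (norm_nonneg _), ofReal_norm]
      · rw [hr, Set.indicator_of_notMem hx, Set.indicator_of_notMem hx, ENNReal.ofReal_zero]
    have hXtop : X ≠ ∞ := by
      rw [hXr, ← ofReal_integral_eq_lintegral_ofReal hri (Filter.Eventually.of_forall hr0)]
      exact ENNReal.ofReal_ne_top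
    have hFu : ∀ x, F x * u x = ((r x : ℝ) : ℂ) := by
      intro x
      by_cases hx : x ∈ A N
      · rw [hu, hr, Set.indicator_of_mem hx, Set.indicator_of_mem hx, ← mul_assoc, Complex.mul_conj,
          Complex.normSq_eq_norm_sq]
        push_cast; rfl
      · rw [hu, hr, Set.indicator_of_notMem hx, Set.indicator_of_notMem hx]; simp
    have huX : ∫⁻ x, ‖u x‖ₑ ^ 2 / ENNReal.ofReal (w x) = X := by
      refine lintegral_congr fun x => ?_
      by_cases hx : x ∈ A N
      · have hw0 : ENNReal.ofReal (w x) ≠ 0 := by simpa using hAw N x hx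
        rw [hu, Set.indicator_of_mem hx, Set.indicator_of_mem hx, hg, enorm_mul, RCLike.enorm_conj,
          mul_pow]
        have : ‖(w x : ℂ)‖ₑ = ENNReal.ofReal (w x) := by
          rw [← ofReal_norm, Complex.norm_real, Real.norm_eq_abs, abs_of_pos (hAw N x hx)]
        rw [this, mul_div_assoc, pow_two (ENNReal.ofReal (w x)),
          ENNReal.mul_div_cancel_right hw0 ENNReal.ofReal_ne_top]
      · rw [hu, Set.indicator_of_notMem hx, Set.indicator_of_notMem hx]; simp
    have hform : ∫⁻ ω, ‖waveTransform u (ω : EuclideanSpace ℝ (Fin n))‖ₑ ^ 2 ∂(surfaceMeasure n) ≤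
        ENNReal.ofReal C * X := by
      rw [lintegral_waveTransform_sq_eq_enorm_convForm (surfaceMeasure n) measurable_subtype_coe
        fourierSphere_one_eq hui, ← huX]
      refine hC w hw hball u N hui hum fun x hx => ?_
      by_contra hmem
      exact hx (Set.indicator_of_notMem (fun h => hmem h.2) _)
    have hCne : ENNReal.ofReal C ≠ 0 := by simpa using hC0
    have ht : 2 * ENNReal.ofReal C ≠ 0 := mul_ne_zero two_ne_zero hCne
    have ht' : 2 * ENNReal.ofReal C ≠ ∞ := ENNReal.mul_ne_top (by simp) ENNReal.ofReal_ne_top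
    have hTm := (continuous_waveTransform hui).measurable
    -- half of `X` is absorbed into the left hand side
    have hX2 : X ≤ 2 * ENNReal.ofReal C * (∫⁻ ω, ‖f ω‖ₑ ^ 2 ∂(surfaceMeasure n)) + 2⁻¹ * X := by
      calc X = ‖∫ x, F x * u x‖ₑ := by
            simp_rw [hFu]
            rw [enorm_integral_ofReal hri hr0, hXr]
        _ = ‖∫ ω, f ω * waveTransform u (ω : EuclideanSpace ℝ (Fin n)) ∂(surfaceMeasure n)‖ₑ := by
            rw [hF, integral_fourierSphere_mul hfi hui]
        _ ≤ ∫⁻ ω, (2 * ENNReal.ofReal C * ‖f ω‖ₑ ^ 2 + (2 * ENNReal.ofReal C)⁻¹ *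
              ‖waveTransform u (ω : EuclideanSpace ℝ (Fin n))‖ₑ ^ 2) ∂(surfaceMeasure n) := by
            refine (enorm_integral_le_lintegral_enorm _).trans (lintegral_mono fun ω => ?_)
            rw [enorm_mul]
            exact ENNReal.mul_le_weighted_sq_add_sq ht ht' _ _
        _ = 2 * ENNReal.ofReal C * (∫⁻ ω, ‖f ω‖ₑ ^ 2 ∂(surfaceMeasure n)) +
              (2 * ENNReal.ofReal C)⁻¹ *
              ∫⁻ ω, ‖waveTransform u (ω : EuclideanSpace ℝ (Fin n))‖ₑ ^ 2 ∂(surfaceMeasure n) := by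
            rw [lintegral_add_right _ (by fun_prop), lintegral_const_mul' _ _ ht',
              lintegral_const_mul _ (by fun_prop)]
        _ ≤ 2 * ENNReal.ofReal C * (∫⁻ ω, ‖f ω‖ₑ ^ 2 ∂(surfaceMeasure n)) +
              (2 * ENNReal.ofReal C)⁻¹ * (ENNReal.ofReal C * X) := by gcongr
        _ = _ := by
            rw [ENNReal.mul_inv (Or.inl (by simp)) (Or.inl (by simp)), mul_assoc (2⁻¹ : ℝ≥0∞),
              ← mul_assoc _ _ X, ENNReal.inv_mul_cancel hCne ENNReal.ofReal_ne_top, one_mul]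
    have hhalf : 2⁻¹ * X ≤ 2 * ENNReal.ofReal C * (∫⁻ ω, ‖f ω‖ₑ ^ 2 ∂(surfaceMeasure n)) := by
      have h1 : 2⁻¹ * X + 2⁻¹ * X = X := by
        rw [← add_mul, ENNReal.inv_two_add_inv_two, one_mul]
      refine ENNReal.le_of_add_le_add_right (a := 2⁻¹ * X)
        (ENNReal.mul_ne_top (by simp) hXtop) ?_
      rwa [h1]
    calc X = 2 * (2⁻¹ * X) := by
          rw [← mul_assoc, ENNReal.mul_inv_cancel two_ne_zero (by simp), one_mul]
      _ ≤ 2 * (2 * ENNReal.ofReal C * (∫⁻ ω, ‖f ω‖ₑ ^ 2 ∂(surfaceMeasure n))) := by gcongr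
      _ = _ := by
          rw [ENNReal.ofReal_mul (by norm_num), ENNReal.ofReal_ofNat]
          ring
  have hlim : Filter.Tendsto (fun N => ∫⁻ x, (A N).indicator g x) Filter.atTop
      (nhds (∫⁻ x, g x)) := by
    refine lintegral_tendsto_of_tendsto_of_monotone
      (fun N => (hgm.indicator (hAm N)).aemeasurable) ?_ ?_
    · refine Filter.Eventually.of_forall fun x i j hij => ?_
      refine Set.indicator_le_indicator_of_subset (fun y hy => ?_) (fun _ => zero_le) x
      refine ⟨Metric.ball_subset_ball (by exact_mod_cast hij) hy.1, ?_, ?_⟩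
      · exact (zpow_le_zpow_right₀ one_le_two (by omega)).trans hy.2.1
      · exact hy.2.2.trans_le (zpow_le_zpow_right₀ one_le_two (by omega))
    · refine Filter.Eventually.of_forall fun x => ?_
      rcases le_or_gt (w x) 0 with hw0 | hw0
      · have h1 : g x = 0 := by simp [hg, ENNReal.ofReal_of_nonpos hw0]
        have h2 : ∀ N, (A N).indicator g x = 0 := fun N => by
          rw [Set.indicator_apply_eq_zero]; exact fun _ => h1
        simp [h1, h2]
      · obtain ⟨N₁, hN₁⟩ := exists_nat_gt ‖x‖
        obtain ⟨N₂, hN₂⟩ := pow_unbounded_of_one_lt (w x) (one_lt_two : (1 : ℝ) < 2)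
        obtain ⟨N₃, hN₃⟩ := pow_unbounded_of_one_lt (w x)⁻¹ (one_lt_two : (1 : ℝ) < 2)
        refine tendsto_const_nhds.congr' ?_
        filter_upwards [Filter.eventually_ge_atTop (max N₁ (max N₂ N₃))] with N hN
        rw [max_le_iff, max_le_iff] at hN
        refine (Set.indicator_of_mem ?_ _).symm
        refine ⟨?_, ?_, ?_⟩
        · rw [mem_ball_zero_iff]
          exact hN₁.trans_le (by exact_mod_cast hN.1)
        · rw [zpow_neg, zpow_natCast]
          apply inv_le_of_inv_le₀ hw0
          exact hN₃.le.trans (pow_le_pow_right₀ one_le_two hN.2.2)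
        · rw [zpow_natCast]
          exact hN₂.trans_le (pow_le_pow_right₀ one_le_two hN.2.1)
  exact le_of_tendsto' hlim hbound

lemma eLpNorm_fourierSphere_weightMeasure {w : EuclideanSpace ℝ (Fin n) → ℝ} (hw : AEMeasurable w)
    {f : Metric.sphere (0 : EuclideanSpace ℝ (Fin n)) 1 → ℂ}
    (hf : Integrable f (surfaceMeasure n)) :
    eLpNorm (fourierSphere f) 2 (weightMeasure w) =
      (∫⁻ x, ‖fourierSphere f x‖ₑ ^ 2 * ENNReal.ofReal (w x)) ^ (1 / 2 : ℝ) := by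
  have hF := (continuous_fourierSphere hf).measurable
  rw [eLpNorm_eq_lintegral_rpow_enorm_toReal two_ne_zero ENNReal.ofNat_ne_top, weightMeasure,
    lintegral_withDensity_eq_lintegral_mul₀ hw.ennreal_ofReal (by fun_prop)]
  simp only [ENNReal.toReal_ofNat, ENNReal.rpow_ofNat, Pi.mul_apply]
  simp_rw [mul_comm]

/-- The estimate for an arbitrary bound `T` on the Kerman–Sawyer norm, by rescaling the weight. -/
theorem exists_eLpNorm_fourierSphere_le (hn : 2 ≤ n) {α β : ℝ} (hβ : 1 ≤ β)
    (hα : β + ((n : ℝ) - 1) / 2 < α) (hα' : α < (n : ℝ)) : ∃ C : ℝ, 0 < C ∧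
    ∀ w : EuclideanSpace ℝ (Fin n) → ℝ, (∀ x, 0 ≤ w x) →
      LocallyIntegrable (fun x => w x ^ β) volume →
    ∀ f : Metric.sphere (0 : EuclideanSpace ℝ (Fin n)) 1 → ℂ, MemLp f 2 (surfaceMeasure n) →
    ∀ T : ℝ, 0 < T → kermanSawyerNorm α (fun x => w x ^ β) ≤ ENNReal.ofReal T →
      eLpNorm (fourierSphere f) 2 (weightMeasure w) ≤
        ENNReal.ofReal C * ENNReal.ofReal T ^ (1 / (2 * β)) * eLpNorm f 2 (surfaceMeasure n) := by
  have hβ0 : 0 < β := by linarith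
  obtain ⟨C₁, hC₁0, hC₁⟩ := exists_setLIntegral_ball_le (n := n) (by omega) hα'
  obtain ⟨C₂, hC₂0, hC₂⟩ := exists_lintegral_fourierSphere_sq_le hn (s := (n : ℝ) - α) hβ
    (by linarith)
  refine ⟨(C₁ ^ (1 / β) * C₂) ^ (1 / 2 : ℝ), by positivity, fun w hw0 hw f hf T hT hKS => ?_⟩
  have hfi : Integrable f (surfaceMeasure n) := hf.integrable one_le_two
  -- only `w ^ β` is assumed measurable; `w` is recovered as its power
  have hwm : AEMeasurable w := by
    have h1 := (hw.aestronglyMeasurable.aemeasurable).pow_const (1 / β)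
    refine h1.congr (Filter.Eventually.of_forall fun x => ?_)
    simp only
    rw [← Real.rpow_mul (hw0 x), mul_one_div_cancel hβ0.ne', Real.rpow_one]
  set lam : ℝ := (T * C₁) ^ (1 / β) with hlam
  have hlam0 : 0 < lam := by positivity
  have hlamβ : lam ^ β = T * C₁ := by
    rw [hlam, ← Real.rpow_mul (by positivity), one_div_mul_cancel hβ0.ne', Real.rpow_one]
  set w' : EuclideanSpace ℝ (Fin n) → ℝ := fun x => hwm.mk w x / lam with hw'
  have hae : ∀ᵐ x, w' x = w x / lam := by
    filter_upwards [hwm.ae_eq_mk] with x hx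
    rw [hw', hx]
  have hball : ∀ (x : EuclideanSpace ℝ (Fin n)) (r : ℝ), 0 < r →
      ∫⁻ y in Metric.ball x r, ENNReal.ofReal (w' y ^ β) ≤ ENNReal.ofReal (r ^ ((n : ℝ) - α)) := by
    intro x r hr
    have h1 : ∫⁻ y in Metric.ball x r, ENNReal.ofReal (w' y ^ β) =
        ENNReal.ofReal (T * C₁)⁻¹ * ∫⁻ y in Metric.ball x r, ENNReal.ofReal (w y ^ β) := by
      rw [← lintegral_const_mul' _ _ ENNReal.ofReal_ne_top]
      refine lintegral_congr_ae (ae_restrict_of_ae ?_)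
      filter_upwards [hae] with y hy
      rw [hy, ← ENNReal.ofReal_mul (by positivity), Real.div_rpow (hw0 y) hlam0.le, hlamβ,
        div_eq_inv_mul]
    rw [h1]
    refine (mul_le_mul_right (hC₁ _ (fun x => Real.rpow_nonneg (hw0 x) _) hw x r hr) _).trans ?_
    refine (mul_le_mul_right (mul_le_mul_left hKS _) _).trans_eq ?_
    rw [← ENNReal.ofReal_mul hT.le, ← ENNReal.ofReal_mul (by positivity)]
    congr 1
    field_simp
  have hmain := hC₂ w' (by fun_prop) hball f hf
  have hscale : ∫⁻ x, ‖fourierSphere f x‖ₑ ^ 2 * ENNReal.ofReal (w x) =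
      ENNReal.ofReal lam * ∫⁻ x, ‖fourierSphere f x‖ₑ ^ 2 * ENNReal.ofReal (w' x) := by
    rw [← lintegral_const_mul' _ _ ENNReal.ofReal_ne_top]
    refine lintegral_congr_ae ?_
    filter_upwards [hae] with x hx
    rw [hx, mul_left_comm, ← ENNReal.ofReal_mul hlam0.le, mul_div_cancel₀ _ hlam0.ne']
  rw [eLpNorm_fourierSphere_weightMeasure hwm hfi, hscale]
  have hnorm : eLpNorm f 2 (surfaceMeasure n) =
      (∫⁻ ω, ‖f ω‖ₑ ^ 2 ∂(surfaceMeasure n)) ^ (1 / 2 : ℝ) := by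
    rw [eLpNorm_eq_lintegral_rpow_enorm_toReal two_ne_zero ENNReal.ofNat_ne_top]
    simp only [ENNReal.toReal_ofNat, ENNReal.rpow_ofNat]
  rw [hnorm]
  calc _ ≤ (ENNReal.ofReal lam * (ENNReal.ofReal C₂ *
        ∫⁻ ω, ‖f ω‖ₑ ^ 2 ∂(surfaceMeasure n))) ^ (1 / 2 : ℝ) := by gcongr
    _ = _ := by
        rw [← mul_assoc, ENNReal.mul_rpow_of_nonneg _ _ (by norm_num : (0 : ℝ) ≤ 1 / 2),
          ← ENNReal.ofReal_mul hlam0.le,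
          ENNReal.ofReal_rpow_of_nonneg (by positivity) (by norm_num),
          ENNReal.ofReal_rpow_of_pos hT, ← ENNReal.ofReal_mul (by positivity)]
        congr 2
        rw [hlam, Real.mul_rpow hT.le hC₁0.le, mul_assoc,
          Real.mul_rpow (by positivity) (by positivity), ← Real.rpow_mul hT.le, mul_comm]
        congr 2
        field_simp

end

theorem proposition1 (n : ℕ) (hn : 2 ≤ n) (α β : ℝ) (hβ : 1 ≤ β) (hβ' : β < ((n : ℝ) + 1) / 2)
    (hα : β + ((n : ℝ) - 1) / 2 < α) (hα' : α < (n : ℝ)) :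
    ∃ C : ℝ≥0, 0 < C ∧
      ∀ w : EuclideanSpace ℝ (Fin n) → ℝ, (∀ x, 0 ≤ w x) →
        LocallyIntegrable (fun x => w x ^ β) volume →
      ∀ f : Metric.sphere (0 : EuclideanSpace ℝ (Fin n)) 1 → ℂ, MemLp f 2 (surfaceMeasure n) →
        eLpNorm (fourierSphere f) 2 (weightMeasure w) ≤
          (C : ℝ≥0∞) * kermanSawyerNorm α (fun x => w x ^ β) ^ (1 / (2 * β)) *
            eLpNorm f 2 (surfaceMeasure n) := by
  obtain ⟨C, hC0, hC⟩ := exists_eLpNorm_fourierSphere_le hn hβ hα hα'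
  have hexp : 0 < 1 / (2 * β) := by positivity
  refine ⟨C.toNNReal, Real.toNNReal_pos.2 hC0, fun w hw0 hw f hf => ?_⟩
  change _ ≤ ENNReal.ofReal C * _ * _
  set V := kermanSawyerNorm α (fun x => w x ^ β) with hV
  rcases eq_or_ne V ∞ with hVtop | hVtop
  · rcases eq_or_ne (eLpNorm f 2 (surfaceMeasure n)) 0 with hf0 | hf0
    · -- here the right-hand side is `∞ * 0 = 0`, and the left-hand side vanishes too
      have hfae := (eLpNorm_eq_zero_iff hf.1 two_ne_zero).1 hf0
      have hzero : fourierSphere f = 0 := by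
        funext x
        refine integral_eq_zero_of_ae ?_
        filter_upwards [hfae] with ω hω
        simp [hω]
      rw [hzero]
      simp
    · rw [hVtop, ENNReal.top_rpow_of_pos hexp, ENNReal.mul_top (by simpa using hC0),
        ENNReal.top_mul hf0]
      exact le_top
  · -- let `T` decrease to `V`; this covers `V = 0` as well
    have hlim : Filter.Tendsto (fun T : ℝ => ENNReal.ofReal C * ENNReal.ofReal T ^ (1 / (2 * β)) *
        eLpNorm f 2 (surfaceMeasure n)) (nhdsWithin V.toReal (Set.Ioi V.toReal))
        (nhds (ENNReal.ofReal C * V ^ (1 / (2 * β)) * eLpNorm f 2 (surfaceMeasure n))) := by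
      have h1 : Filter.Tendsto (fun T : ℝ => ENNReal.ofReal T) (nhds V.toReal) (nhds V) := by
        simpa [ENNReal.ofReal_toReal hVtop] using
          (ENNReal.continuous_ofReal.tendsto V.toReal)
      have h2 := (ENNReal.continuous_rpow_const (y := 1 / (2 * β))).tendsto V |>.comp h1
      have h3 := ENNReal.Tendsto.const_mul (a := ENNReal.ofReal C) h2 (Or.inr ENNReal.ofReal_ne_top)
      exact (ENNReal.Tendsto.mul_const h3 (Or.inr hf.eLpNorm_ne_top)).mono_left nhdsWithin_le_nhds
    refine ge_of_tendsto hlim ?_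
    filter_upwards [self_mem_nhdsWithin] with T hT
    have hT' : V.toReal < T := hT
    refine hC w hw0 hw f hf T (ENNReal.toReal_nonneg.trans_lt hT') ?_
    rw [← hV, ← ENNReal.ofReal_toReal hVtop]
    exact ENNReal.ofReal_le_ofReal hT'.le
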